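/- Definitions. A meet-semilattice (a poset with all finite meets, hence with a top $1$) is distributive if $a\wedge b\le c$ implies $c=a'\wedge b'$ for some $a'\ge a$, $b'\ge b$. $\mathsf{BDMS}$ is the category of distributive meet-semilattices with a bottom element and maps preserving finite meets (including $1$). $\mathsf{KAlgFrm_J}$ is the category of compact algebraic frames (algebraic lattices that are frames and whose top is compact) and maps preserving arbitrary joins and compact elements. Let $X$ be a Priestley space (a compact partially ordered space in which $x\not\le y$ implies that some clopen upset contains $x$ and misses $y$) and $X_0\subseteq X$. A clopen upset $U$ is admissible if every maximal element of $X\setminus U$ is in $X_0$; $\mathcal A(X)$ is the set of these. A closed upset $C$ is admissible if $X\setminus C={\downarrow}(X_0\setminus C)$; $\mathcal V^a(X)$ is the set of these. $(X,X_0)$ is a generalized Priestley space if $X_0$ is topologically dense, every $x\in X$ is below some $y\in X_0$, $x\in X_0$ iff $\{U\in\mathcal A(X): x\notin U\}$ is directed under $\subseteq$, and $x\le y$ iff every $U\in\mathcal A(X)$ containing $x$ contains $y$. For $R\subseteq X\times Y$ and $U\subseteq Y$ put $\Box_RU=\{x: R[x]\subseteq U\}$. $R$ is a generalized Priestley morphism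 if (1) $\neg\, xRy$ implies that there is $U\in\mathcal A(Y)$ with $R[x]\subseteq U$, $y\notin U$; (2) $U\in\mathcal A(Y)$ implies $\Box_RU\in\mathcal A(X)$. $\mathsf{GPS}$ is the category of generalized Priestley spaces and these morphisms; the identity of $X$ is $\le$, and $x(S*R)z$ iff every $U\in\mathcal A(Z)$ with $x\in\Box_R\Box_SU$ contains $z$. Statement. The following are well-defined functors. - $\mathcal F:\mathsf{BDMS}\to\mathsf{KAlgFrm_J}$ sends $M$ to its lattice $\mathrm{Filt}(M)$ of filters under inclusion, and $\alpha$ to $F\mapsto{\uparrow}\alpha[F]$. - $\mathcal K:\mathsf{KAlgFrm_J}\to\mathsf{BDMS}$ sends $L$ to its set $K(L)$ of compact elements with the order $\ge$, and $\alpha$ to its restriction. - $\mathcal A:\mathsf{GPS}^{op}\to\mathsf{BDMS}$ sends $X$ to $(\mathcal A(X),\subseteq)$, and $R$ to $\Box_R$. - $\mathcal V^a:\mathsf{GPS}^{op}\to\mathsf{KAlgFrm_J}$ sends $X$ to $(\mathcal V^a(X),\supseteq)$, and $R$ to $\Box_R$. - $\mathcal X:\mathsf{BDMS}\to\mathsf{GPS}^{op}$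 sends $M$ to the set $\mathrm{Opt}(M)$ of optimal filters ordered by inclusion, with the topology generated by the sets $\{x: a\in x\}$ ($a\in M$) and their complements and with distinguished subset the set of prime filters, and sends $\alpha$ to $R_\alpha$, where $xR_\alpha y$ iff $\alpha^{-1}(x)\subseteq y$. Here a filter $P$ is prime if it is proper and $F_1\cap F_2\subseteq P$ implies $F_1\subseteq P$ or $F_2\subseteq P$ for all filters $F_1,F_2$; a filter is optimal if it is the preimage of a prime filter of the distributive envelope $D(M)$ under $M\to D(M)$, $D$ being left adjoint to the forgetful functor from bounded distributive lattices to $\mathsf{BDMS}$-objects with maps preserving finite meets and existing finite joins. - $\mathcal Y:\mathsf{KAlgFrm_J}\to\mathsf{GPS}^{op}$ sends $L$ to the set $PP(L)$ of pseudoprime elements ($p\ne1$ such that $a_1\wedge\dots\wedge a_n\ll p$ implies $a_i\le p$ for some $i$) with the order of $L$, the subspace topology of the topology on $L$ generated by the sets ${\uparrow}k$ ($k\in K(L)$) and their complements, and with distinguished subset the set of (meet-)prime elements of $L$, and sends $\alpha$ to $R_\alpha$, where $pR_\alpha q$ iff $r(p)\le q$, $r$ being the right adjoint of $\alpha$. $\mathcal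 F$ and $\mathcal K$ are quasi-inverse equivalences between $\mathsf{BDMS}$ and $\mathsf{KAlgFrm_J}$; $\mathcal Y$ and $\mathcal V^a$ are quasi-inverse dual equivalences between $\mathsf{KAlgFrm_J}$ and $\mathsf{GPS}$; $\mathcal X$ and $\mathcal A$ are quasi-inverse dual equivalences between $\mathsf{BDMS}$ and $\mathsf{GPS}$ (generalized Priestley duality). Moreover, the optimal filters of $M\in\mathsf{BDMS}$ are exactly the pseudoprime elements of $\mathrm{Filt}(M)$, and $\mathcal X=\mathcal Y\circ\mathcal F$ and $\mathcal A=\mathcal K\circ\mathcal V^a$, in the sense that the identity maps on the underlying sets (for $\mathcal X$: the relations $P\subseteq F$) are natural isomorphisms. -/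

import Mathlib

open CategoryTheory Opposite Order

universe u

namespace GenPriestley

/-! ### Meet-semilattices

`SemilatInfCat` is the category of meet-semilattices with top; its morphisms preserve all finite
meets (including the top). -/

/-- A meet-semilattice is distributive if `a ⊓ b ≤ c` implies `c = a' ⊓ b'` for some `a' ≥ a` and
`b' ≥ b`. -/
def IsDistributiveMeetSemilattice (M : Type u) [SemilatticeInf M] : Prop :=
  ∀ a b c : M, a ⊓ b ≤ c → ∃ a' b' : M, a ≤ a' ∧ b ≤ b' ∧ a' ⊓ b' = c

/-- Distributive meet-semilattices that have a bottom element. -/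
def isBDMS : ObjectProperty SemilatInfCat.{u} := fun M =>
  IsDistributiveMeetSemilattice M ∧ ∃ b : M, ∀ a : M, b ≤ a

/-- Bounded distributive meet-semilattices, as a full subcategory of meet-semilattices (so the
morphisms preserve finite meets and the top, but need not preserve the bottom). -/
abbrev BDMS : Type (u + 1) := isBDMS.{u}.FullSubcategory

/-- The meet-semilattice homomorphism underlying a morphism. -/
abbrev BDMS.toHom {M N : BDMS.{u}} (f : M ⟶ N) : InfTopHom M.obj N.obj :=
  ConcreteCategory.hom f.hom

/-! ### Algebraic lattices and compact algebraic frames -/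

/-- Algebraic lattices. -/
structure AlgLat : Type (u + 1) where
  carrier : Type u
  [lattice : CompleteLattice carrier]
  [algebraic : IsCompactlyGenerated carrier]

attribute [instance] AlgLat.lattice AlgLat.algebraic

instance : CoeSort AlgLat.{u} (Type u) := ⟨AlgLat.carrier⟩

/-- Maps that preserve arbitrary joins and compact elements. -/
@[ext]
structure AlgLatHom (L M : Type u) [CompleteLattice L] [CompleteLattice M] where
  toFun : L → M
  map_sSup : ∀ S : Set L, toFun (sSup S) = sSup (toFun '' S)
  map_compact : ∀ k : L, IsCompactElement k → IsCompactElement (toFun k)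

instance : Category AlgLat.{u} where
  Hom L M := AlgLatHom L M
  id L := ⟨id, by simp, fun _ h => h⟩
  comp f g := ⟨g.toFun ∘ f.toFun, fun S => by
      simp only [Function.comp_apply, f.map_sSup, g.map_sSup, Set.image_image],
    fun k hk => g.map_compact _ (f.map_compact _ hk)⟩

/-- The map underlying a morphism of algebraic lattices. -/
def AlgLat.toHom {L M : AlgLat.{u}} (f : L ⟶ M) : AlgLatHom L M := f

/-- The join infinite distributive law. -/
def IsFrameLattice (L : Type u) [CompleteLattice L] : Prop :=
  ∀ (a : L) (S : Set L), a ⊓ sSup S = sSup ((fun s => a ⊓ s) '' S)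

/-- Algebraic lattices that are frames and have a compact top element. -/
def isKAlgFrm : ObjectProperty AlgLat.{u} := fun L =>
  IsFrameLattice L ∧ IsCompactElement (⊤ : L)

/-- Compact algebraic frames, as a full subcategory of algebraic lattices: the morphisms preserve
arbitrary joins and compact elements, but need not preserve finite meets. -/
abbrev KAlgFrmJ : Type (u + 1) := isKAlgFrm.{u}.FullSubcategory

/-- The map underlying a morphism of compact algebraic frames. -/
abbrev KAlgFrmJ.toHom {L M : KAlgFrmJ.{u}} (f : L ⟶ M) : AlgLatHom L.obj M.obj :=
  AlgLat.toHom f.hom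

/-! ### Generalized Priestley spaces -/

section Spaces

variable {X : Type u} [PartialOrder X] [TopologicalSpace X]

/-- Admissible clopen upsets, with respect to a subset `X₀`: the maximal elements of the complement
lie in `X₀`. -/
def IsAdmissible (X₀ : Set X) (U : Set X) : Prop :=
  IsClopen U ∧ IsUpperSet U ∧ {x | Maximal (· ∈ Uᶜ) x} ⊆ X₀

/-- Admissible closed upsets, with respect to a subset `X₀`. -/
def IsAdmissibleClosed (X₀ : Set X) (C : Set X) : Prop :=
  IsClosed C ∧ IsUpperSet C ∧ Cᶜ = {x | ∃ y ∈ X₀ \ C, x ≤ y}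

variable (X) in
/-- The axioms of a generalized Priestley space. -/
structure IsGPS (X₀ : Set X) : Prop where
  compact : CompactSpace X
  priestley : PriestleySpace X
  dense : Dense X₀
  order_dense : ∀ x : X, ∃ y ∈ X₀, x ≤ y
  mem_iff : ∀ x : X, x ∈ X₀ ↔ DirectedOn (· ⊆ ·) {U | IsAdmissible X₀ U ∧ x ∉ U}
  le_iff : ∀ x y : X, x ≤ y ↔ ∀ U, IsAdmissible X₀ U → x ∈ U → y ∈ U

end Spaces

/-- Generalized Priestley spaces. -/
structure GPS : Type (u + 1) where
  carrier : Type u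
  [order : PartialOrder carrier]
  [top : TopologicalSpace carrier]
  X₀ : Set carrier
  isGPS : IsGPS carrier X₀

attribute [instance] GPS.order GPS.top

instance : CoeSort GPS.{u} (Type u) := ⟨GPS.carrier⟩

/-- `box R U = {x | R[x] ⊆ U}`. -/
def box {X Y : Type u} (R : X → Y → Prop) (U : Set Y) : Set X := {x | ∀ y, R x y → y ∈ U}

/-- The two conditions on a generalized Priestley morphism. -/
structure IsGPMorphism {X Y : Type u} [PartialOrder X] [TopologicalSpace X] [PartialOrder Y]
    [TopologicalSpace Y] (X₀ : Set X) (Y₀ : Set Y) (R : X → Y → Prop) : Prop where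
  exists_of_not_rel : ∀ x y, ¬ R x y →
    ∃ U, IsAdmissible Y₀ U ∧ (∀ z, R x z → z ∈ U) ∧ y ∉ U
  box_admissible : ∀ U, IsAdmissible Y₀ U → IsAdmissible X₀ (box R U)

/-- Generalized Priestley morphisms. -/
@[ext]
structure GPSHom (X Y : GPS.{u}) where
  rel : X → Y → Prop
  isGPMorphism : IsGPMorphism X.X₀ Y.X₀ rel

/-- The composition `S * R` of `R ⊆ X × Y` and `S ⊆ Y × Z`, where `Z₀` is the distinguished subset
of `Z`. -/
def relComp {X Y Z : Type u} [PartialOrder Z] [TopologicalSpace Z] (Z₀ : Set Z)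
    (R : X → Y → Prop) (S : Y → Z → Prop) : X → Z → Prop :=
  fun x z => ∀ U, IsAdmissible Z₀ U → x ∈ box R (box S U) → z ∈ U

theorem box_relComp {X Y Z : Type u} [PartialOrder Z] [TopologicalSpace Z] (Z₀ : Set Z)
    (R : X → Y → Prop) (S : Y → Z → Prop) {U : Set Z} (hU : IsAdmissible Z₀ U) :
    box (relComp Z₀ R S) U = box R (box S U) := by
  ext x
  refine ⟨fun h y hy z hz => h z fun W _ hW => hW y hy z hz, fun h z hz => hz U hU h⟩

theorem box_le {X : Type u} [PartialOrder X] {U : Set X} (hU : IsUpperSet U) :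
    box (fun x y : X => x ≤ y) U = U := by
  ext x
  exact ⟨fun h => h x le_rfl, fun h y hy => hU hy h⟩

/-- Generalized Priestley spaces with generalized Priestley morphisms; the identity of `X` is its
order, and the composition of `R` followed by `S` is `S * R`. -/
instance : Category GPS.{u} where
  Hom X Y := GPSHom X Y
  id X :=
    { rel := fun x y => x ≤ y
      isGPMorphism :=
        { exists_of_not_rel := fun x y h => by
            rw [X.isGPS.le_iff] at h
            push Not at h
            obtain ⟨U, hU, hx, hy⟩ := h
            exact ⟨U, hU, fun z hz => hU.2.1 hz hx, hy⟩
          box_admissible := fun U hU => by rwa [box_le hU.2.1] } }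
  comp {X Y Z} R S :=
    { rel := relComp Z.X₀ R.rel S.rel
      isGPMorphism :=
        { exists_of_not_rel := fun x z h => by
            unfold relComp at h
            push Not at h
            obtain ⟨U, hU, hx, hz⟩ := h
            rw [← box_relComp Z.X₀ R.rel S.rel hU] at hx
            exact ⟨U, hU, hx, hz⟩
          box_admissible := fun U hU => by
            rw [box_relComp _ _ _ hU]
            exact R.isGPMorphism.box_admissible _ (S.isGPMorphism.box_admissible _ hU) } }
  id_comp {X Y} R := by
    apply GPSHom.ext
    funext x y
    refine propext ⟨fun h => ?_, fun h U hU hx => hx x le_rfl y h⟩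
    by_contra hn
    obtain ⟨U, hU, hx, hy⟩ := R.isGPMorphism.exists_of_not_rel x y hn
    refine hy (h U hU ?_)
    rw [box_le (R.isGPMorphism.box_admissible U hU).2.1]
    exact hx
  comp_id {X Y} R := by
    apply GPSHom.ext
    funext x y
    refine propext ⟨fun h => ?_, fun h U hU hx => hx y h y le_rfl⟩
    by_contra hn
    obtain ⟨U, hU, hx, hy⟩ := R.isGPMorphism.exists_of_not_rel x y hn
    refine hy (h U hU ?_)
    rw [box_le hU.2.1]
    exact hx
  assoc {W X Y Z} R S T := by
    apply GPSHom.ext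
    funext x z
    refine propext (forall₂_congr fun U hU => ?_)
    rw [box_relComp _ _ _ (T.isGPMorphism.box_admissible U hU), box_relComp _ _ _ hU]

/-- The generalized Priestley morphism underlying a morphism of generalized Priestley spaces. -/
def GPS.toHom {X Y : GPS.{u}} (f : X ⟶ Y) : GPSHom X Y := f

/-! ### The filter functor -/

section Filters

variable {M N : Type u} [SemilatticeInf M] [OrderTop M] [SemilatticeInf N] [OrderTop N]

/-- The intersection of a family of filters. -/
instance : InfSet (PFilter M) where
  sInf S := (IsPFilter.of_def (F := {a : M | ∀ F ∈ S, a ∈ F}) ⟨⊤, fun _ _ => PFilter.top_mem⟩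
    (fun a ha b hb => ⟨a ⊓ b, fun F hF => PFilter.inf_mem (ha F hF) (hb F hF),
      inf_le_left, inf_le_right⟩)
    (fun hab ha F hF => PFilter.mem_of_le hab (ha F hF))).toPFilter

/-- Filters ordered by inclusion form a complete lattice, with intersections as meets. -/
instance : CompleteLattice (PFilter M) :=
  completeLatticeOfInf (PFilter M) fun _ =>
    ⟨fun _ hF _ ha => ha _ hF, fun _ hG _ ha F hF => hG hF ha⟩

/-- The filter `↑α[F]` generated by the image of a filter `F`. -/
def filterMap (α : InfTopHom M N) (F : PFilter M) : PFilter N :=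
  (IsPFilter.of_def (F := {b : N | ∃ a ∈ F, α a ≤ b}) ⟨⊤, ⊤, PFilter.top_mem, le_top⟩
    (fun b ⟨a, ha, hab⟩ b' ⟨a', ha', hab'⟩ =>
      ⟨b ⊓ b', ⟨a ⊓ a', PFilter.inf_mem ha ha', by
        rw [map_inf]; exact inf_le_inf hab hab'⟩, inf_le_left, inf_le_right⟩)
    (fun hbb' ⟨a, ha, hab⟩ => ⟨a, ha, hab.trans hbb'⟩)).toPFilter

theorem mem_filterMap {α : InfTopHom M N} {F : PFilter M} {b : N} :
    b ∈ filterMap α F ↔ ∃ a ∈ F, α a ≤ b := Iff.rfl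

end Filters

/-- `M ↦ Filt(M)`, `α ↦ (F ↦ ↑α[F])` takes values in compact algebraic frames. -/
structure FilterWellDefined : Prop where
  algebraic : ∀ M : BDMS.{u}, IsCompactlyGenerated (PFilter M.obj)
  isKAlgFrm : ∀ M : BDMS.{u}, isKAlgFrm (@AlgLat.mk (PFilter M.obj) _ (algebraic M))
  map_sSup : ∀ {M N : BDMS.{u}} (α : M ⟶ N) (S : Set (PFilter M.obj)),
    filterMap (BDMS.toHom α) (sSup S) = sSup (filterMap (BDMS.toHom α) '' S)
  map_compact : ∀ {M N : BDMS.{u}} (α : M ⟶ N) (F : PFilter M.obj),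
    IsCompactElement F → IsCompactElement (filterMap (BDMS.toHom α) F)

/-- The functor `ℱ`. -/
def filterFunctor (h : FilterWellDefined.{u}) : BDMS.{u} ⥤ KAlgFrmJ.{u} where
  obj M := ⟨@AlgLat.mk (PFilter M.obj) _ (h.algebraic M), h.isKAlgFrm M⟩
  map α := ⟨⟨filterMap (BDMS.toHom α), h.map_sSup α, h.map_compact α⟩⟩
  map_id M := by
    apply InducedCategory.hom_ext
    apply AlgLatHom.ext
    funext F
    apply SetLike.ext
    intro b
    exact ⟨fun ⟨a, ha, hab⟩ => PFilter.mem_of_le hab ha, fun hb => ⟨b, hb, le_rfl⟩⟩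
  map_comp {M N K} α β := by
    apply InducedCategory.hom_ext
    apply AlgLatHom.ext
    funext F
    apply SetLike.ext
    intro c
    refine ⟨fun ⟨a, ha, hac⟩ => ⟨BDMS.toHom α a, ⟨a, ha, le_rfl⟩, hac⟩, ?_⟩
    rintro ⟨b, ⟨a, ha, hab⟩, hbc⟩
    exact ⟨a, ha, (OrderHomClass.mono (BDMS.toHom β) hab).trans hbc⟩

/-! ### The compact element functor -/

section Compacts

variable (L : Type u) [CompleteLattice L]

/-- Compact elements, with the dual of the order of `L`. -/
abbrev CompactsDual : Type u := {k : L // IsCompactElement k}ᵒᵈ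

variable {L}

theorem isCompactElement_bot' : IsCompactElement (⊥ : L) :=
  fun _ _ ⟨x, hx⟩ _ _ _ => ⟨x, hx, bot_le⟩

theorem isCompactElement_sup' {k l : L} (hk : IsCompactElement k) (hl : IsCompactElement l) :
    IsCompactElement (k ⊔ l) := by
  intro s u hs hd hu hle
  obtain ⟨x, hx, hkx⟩ := hk s u hs hd hu (le_sup_left.trans hle)
  obtain ⟨y, hy, hly⟩ := hl s u hs hd hu (le_sup_right.trans hle)
  obtain ⟨z, hz, hxz, hyz⟩ := hd x hx y hy
  exact ⟨z, hz, sup_le (hkx.trans hxz) (hly.trans hyz)⟩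

/-- Binary joins of compact elements. -/
instance : SemilatticeSup {k : L // IsCompactElement k} :=
  Subtype.semilatticeSup fun _ _ hk hl => isCompactElement_sup' hk hl

instance : OrderBot {k : L // IsCompactElement k} where
  bot := ⟨⊥, isCompactElement_bot'⟩
  bot_le k := (bot_le : (⊥ : L) ≤ k.1)

/-- The restriction of a map to compact elements. -/
def compactMap {M : Type u} [CompleteLattice M] (α : AlgLatHom L M) :
    InfTopHom (CompactsDual L) (CompactsDual M) where
  toFun k := OrderDual.toDual ⟨α.toFun (OrderDual.ofDual k).1, α.map_compact _ k.2⟩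
  map_inf' k l := by
    apply Subtype.ext
    change α.toFun (k.1 ⊔ l.1) = α.toFun k.1 ⊔ α.toFun l.1
    rw [← sSup_pair, α.map_sSup, Set.image_pair, sSup_pair]
  map_top' := by
    apply Subtype.ext
    change α.toFun ⊥ = ⊥
    rw [← sSup_empty, α.map_sSup, Set.image_empty, sSup_empty]

end Compacts

/-- `L ↦ (K(L), ≥)` takes values in bounded distributive meet-semilattices. -/
def CompactWellDefined : Prop :=
  ∀ L : KAlgFrmJ.{u}, isBDMS (SemilatInfCat.of (CompactsDual L.obj))

/-- The functor `𝒦`, which restricts a morphism to the compact elements. -/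
def compactFunctor (h : CompactWellDefined.{u}) : KAlgFrmJ.{u} ⥤ BDMS.{u} where
  obj L := ⟨SemilatInfCat.of (CompactsDual L.obj), h L⟩
  map α := ⟨ConcreteCategory.ofHom (C := SemilatInfCat) (compactMap (KAlgFrmJ.toHom α))⟩
  map_id _ := rfl
  map_comp _ _ := rfl

/-! ### The functor of admissible clopen upsets -/

section AdmissibleClopen

variable {X : Type u} [PartialOrder X] [TopologicalSpace X]

theorem IsAdmissible.inter {X₀ U V : Set X} (hU : IsAdmissible X₀ U) (hV : IsAdmissible X₀ V) :
    IsAdmissible X₀ (U ∩ V) := by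
  refine ⟨hU.1.inter hV.1, hU.2.1.inter hV.2.1, fun x hx => ?_⟩
  by_cases hxU : x ∈ U
  · have hxV : x ∉ V := fun h => hx.1 ⟨hxU, h⟩
    exact hV.2.2 ⟨hxV, fun y hy hxy => hx.2 (fun h => hy h.2) hxy⟩
  · exact hU.2.2 ⟨hxU, fun y hy hxy => hx.2 (fun h => hy h.1) hxy⟩

theorem IsAdmissible.univ {X₀ : Set X} : IsAdmissible X₀ (Set.univ : Set X) :=
  ⟨isClopen_univ, isUpperSet_univ, fun x hx => (hx.1 (Set.mem_univ x)).elim⟩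

end AdmissibleClopen

/-- The admissible clopen upsets of `X`, ordered by inclusion. -/
abbrev Adm (X : GPS.{u}) : Type u := {U : Set X // IsAdmissible X.X₀ U}

/-- Finite meets are intersections. -/
instance (X : GPS.{u}) : SemilatticeInf (Adm X) :=
  Subtype.semilatticeInf fun _ _ hU hV => IsAdmissible.inter hU hV

instance (X : GPS.{u}) : OrderTop (Adm X) where
  top := ⟨Set.univ, IsAdmissible.univ⟩
  le_top U := Set.subset_univ U.1

/-- `box R` on admissible clopen upsets. -/
def admMap {X Y : GPS.{u}} (R : GPSHom X Y) : InfTopHom (Adm Y) (Adm X) where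
  toFun U := ⟨box R.rel U.1, R.isGPMorphism.box_admissible _ U.2⟩
  map_inf' U V := by
    apply Subtype.ext
    ext x
    exact ⟨fun h => ⟨fun y hy => (h y hy).1, fun y hy => (h y hy).2⟩,
      fun h y hy => ⟨h.1 y hy, h.2 y hy⟩⟩
  map_top' := by
    apply Subtype.ext
    ext x
    exact ⟨fun _ => Set.mem_univ x, fun _ y _ => Set.mem_univ y⟩

/-- `X ↦ 𝒜(X)` takes values in bounded distributive meet-semilattices. -/
def AdmWellDefined : Prop :=
  ∀ X : GPS.{u}, isBDMS (SemilatInfCat.of (Adm X))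

/-- The contravariant functor `𝒜`, which sends `R` to `box R`. -/
def admFunctor (h : AdmWellDefined.{u}) : GPS.{u}ᵒᵖ ⥤ BDMS.{u} where
  obj X := ⟨SemilatInfCat.of (Adm X.unop), h X.unop⟩
  map R := ⟨ConcreteCategory.ofHom (C := SemilatInfCat) (admMap (GPS.toHom R.unop))⟩
  map_id X := by
    apply InducedCategory.hom_ext
    apply InfTopHom.ext
    intro U
    apply Subtype.ext
    exact box_le U.2.2.1
  map_comp R S := by
    apply InducedCategory.hom_ext
    apply InfTopHom.ext
    intro U
    apply Subtype.ext
    exact box_relComp _ _ _ U.2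

/-! ### The functor of admissible closed upsets -/

/-- The admissible closed upsets of `X`, ordered by reverse inclusion. -/
@[ext]
structure ClosedAdm (X : GPS.{u}) : Type u where
  val : Set X
  property : IsAdmissibleClosed X.X₀ val

instance (X : GPS.{u}) : PartialOrder (ClosedAdm X) where
  le C D := D.1 ⊆ C.val
  le_refl _ := subset_rfl
  le_trans _ _ _ h h' := h'.trans h
  le_antisymm _ _ h h' := ClosedAdm.ext (h'.antisymm h)

/-- Joins are intersections. -/
instance (X : GPS.{u}) : SupSet (ClosedAdm X) where
  sSup S := ⟨⋂ C ∈ S, C.val, isClosed_biInter fun C _ => C.property.1,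
    isUpperSet_iInter₂ fun C _ => C.property.2.1, by
      ext x
      constructor
      · intro hx
        simp only [Set.mem_compl_iff, Set.mem_iInter, not_forall] at hx
        obtain ⟨C, hC, hxC⟩ := hx
        have hx' : x ∈ C.valᶜ := hxC
        rw [C.2.2.2] at hx'
        obtain ⟨y, hy, hxy⟩ := hx'
        exact ⟨y, ⟨hy.1, fun h => hy.2 (Set.mem_iInter₂.1 h C hC)⟩, hxy⟩
      · rintro ⟨y, hy, hxy⟩ hx
        exact hy.2 (isUpperSet_iInter₂ (fun C (_ : C ∈ S) => C.2.2.1) hxy hx)⟩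

instance (X : GPS.{u}) : CompleteLattice (ClosedAdm X) :=
  completeLatticeOfSup (ClosedAdm X) fun _ =>
    ⟨fun _ hC _ hx => Set.mem_iInter₂.1 hx _ hC,
      fun _ hD _ hx => Set.mem_iInter₂.2 fun C hC => hD hC hx⟩

/-- `X ↦ (𝒱ᵃ(X), ⊇)`, `R ↦ box R` is contravariantly functorial, with values in compact algebraic
frames. -/
structure VietorisWellDefined : Prop where
  algebraic : ∀ X : GPS.{u}, IsCompactlyGenerated (ClosedAdm X)
  isKAlgFrm : ∀ X : GPS.{u}, isKAlgFrm (@AlgLat.mk (ClosedAdm X) _ (algebraic X))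
  box_mem : ∀ {X Y : GPS.{u}} (R : GPSHom X Y) (C : ClosedAdm Y),
    IsAdmissibleClosed X.X₀ (box R.rel C.val)
  map_sSup : ∀ {X Y : GPS.{u}} (R : GPSHom X Y) (S : Set (ClosedAdm Y)),
    (⟨box R.rel (sSup S).1, box_mem R _⟩ : ClosedAdm X) =
      sSup ((fun C => ⟨box R.rel C.val, box_mem R C⟩) '' S)
  map_compact : ∀ {X Y : GPS.{u}} (R : GPSHom X Y) (C : ClosedAdm Y),
    IsCompactElement C → IsCompactElement (⟨box R.rel C.val, box_mem R C⟩ : ClosedAdm X)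
  map_comp : ∀ {X Y Z : GPS.{u}} (R : GPSHom X Y) (S : GPSHom Y Z) (C : ClosedAdm Z),
    box (relComp Z.X₀ R.rel S.rel) C.val = box R.rel (box S.rel C.val)

/-- The contravariant functor `𝒱ᵃ`. -/
def vietorisFunctor (h : VietorisWellDefined.{u}) : GPS.{u}ᵒᵖ ⥤ KAlgFrmJ.{u} where
  obj X := ⟨@AlgLat.mk (ClosedAdm X.unop) _ (h.algebraic X.unop), h.isKAlgFrm X.unop⟩
  map R := ⟨⟨fun C => ⟨box (GPS.toHom R.unop).rel C.val, h.box_mem (GPS.toHom R.unop) C⟩,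
    h.map_sSup (GPS.toHom R.unop), h.map_compact (GPS.toHom R.unop)⟩⟩
  map_id X := by
    apply InducedCategory.hom_ext
    apply AlgLatHom.ext
    funext C
    exact ClosedAdm.ext (box_le C.2.2.1)
  map_comp R S := by
    apply InducedCategory.hom_ext
    apply AlgLatHom.ext
    funext C
    exact ClosedAdm.ext (h.map_comp (GPS.toHom S.unop) (GPS.toHom R.unop) C)

/-! ### The functor of optimal filters -/

section Optimal

/-- The map `f` preserves all finite joins that exist (including the empty one). -/
def PreservesExistingFiniteJoins {M N : Type u} [Preorder M] [Preorder N] (f : M → N) : Prop :=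
  ∀ (s : Finset M) (a : M), IsLUB (s : Set M) a → IsLUB (f '' (s : Set M)) (f a)

/-- `D`, together with `e : M → D`, is the distributive envelope of `M`: the reflection of `M` from
meet-semilattices, with maps preserving finite meets and existing finite joins, into bounded
distributive lattices. -/
structure IsDistributiveEnvelope {M D : Type u} [SemilatticeInf M] [OrderTop M] [DistribLattice D]
    [BoundedOrder D] (e : InfTopHom M D) : Prop where
  preserves : PreservesExistingFiniteJoins e
  existsUnique : ∀ (E : Type u) [DistribLattice E] [BoundedOrder E] (f : InfTopHom M E),
    PreservesExistingFiniteJoins f → ∃! g : BoundedLatticeHom D E, ∀ a, g (e a) = f a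

variable {M : Type u} [SemilatticeInf M] [OrderTop M]

/-- Prime filters: proper filters `P` such that `F₁ ∩ F₂ ⊆ P` implies `F₁ ⊆ P` or `F₂ ⊆ P`. -/
def IsPrimeFilter (P : PFilter M) : Prop :=
  (∃ a : M, a ∉ P) ∧
    ∀ F₁ F₂ : PFilter M, (F₁ : Set M) ∩ (F₂ : Set M) ⊆ (P : Set M) → F₁ ≤ P ∨ F₂ ≤ P

/-- Optimal filters: the restrictions to `M` of the prime filters of the distributive envelope. -/
def IsOptimal (F : PFilter M) : Prop :=
  ∃ (D : Type u) (_ : DistribLattice D) (_ : BoundedOrder D) (e : InfTopHom M D),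
    IsDistributiveEnvelope e ∧ ∃ P : PFilter D, P.IsPrime ∧ ∀ a : M, a ∈ F ↔ e a ∈ P

variable (M)

/-- The set of optimal filters, ordered by inclusion. -/
abbrev Opt : Type u := {F : PFilter M // IsOptimal F}

/-- The topology generated by the sets `φ(a) = {x | a ∈ x}` and their complements. -/
instance : TopologicalSpace (Opt M) :=
  TopologicalSpace.generateFrom
    ({U | ∃ a : M, U = {x : Opt M | a ∈ x.1}} ∪ {U | ∃ a : M, U = {x : Opt M | a ∈ x.1}ᶜ})

/-- The prime filters, as a subset of the optimal filters. -/
def Opt.primes : Set (Opt M) := {x | IsPrimeFilter x.1}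

variable {M} {N : Type u} [SemilatticeInf N] [OrderTop N]

/-- `x R_α y` iff `α⁻¹(x) ⊆ y`. -/
def optRel (α : InfTopHom M N) : Opt N → Opt M → Prop :=
  fun x y => ∀ a : M, α a ∈ x.1 → a ∈ y.1

end Optimal

/-- `M ↦ ⟨Opt(M), τ, ⊆, Pr(M)⟩`, `α ↦ R_α` is contravariantly functorial, with values in generalized
Priestley spaces. -/
structure OptWellDefined : Prop where
  isGPS : ∀ M : BDMS.{u}, IsGPS (Opt M.obj) (Opt.primes M.obj)
  isGPMorphism : ∀ {M N : BDMS.{u}} (α : M ⟶ N),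
    IsGPMorphism (Opt.primes N.obj) (Opt.primes M.obj) (optRel (BDMS.toHom α))
  map_comp : ∀ {M N K : BDMS.{u}} (α : M ⟶ N) (β : N ⟶ K),
    optRel (BDMS.toHom (α ≫ β)) =
      relComp (Opt.primes M.obj) (optRel (BDMS.toHom β)) (optRel (BDMS.toHom α))

/-- The contravariant functor `𝒳`. -/
def optFunctor (h : OptWellDefined.{u}) : BDMS.{u} ⥤ GPS.{u}ᵒᵖ where
  obj M := op ⟨Opt M.obj, Opt.primes M.obj, h.isGPS M⟩
  map α := Quiver.Hom.op (V := GPS.{u}) ⟨optRel (BDMS.toHom α), h.isGPMorphism α⟩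
  map_id M := rfl
  map_comp α β := by
    apply Quiver.Hom.unop_inj
    apply GPSHom.ext
    exact h.map_comp α β

/-! ### The functor of pseudoprime elements -/

section Pseudoprime

variable (L : Type u) [CompleteLattice L]

variable {L} in
/-- The way below relation. -/
def WayBelow (a b : L) : Prop :=
  ∀ S : Set L, b ≤ sSup S → ∃ T : Finset L, (T : Set L) ⊆ S ∧ a ≤ sSup (T : Set L)

variable {L} in
/-- Pseudoprime elements: `p ≠ ⊤`, and whenever a finite meet is way below `p`, one of its members
is below `p`. -/
def IsPseudoprime (p : L) : Prop :=
  p ≠ ⊤ ∧ ∀ s : Finset L, WayBelow (s.inf id) p → ∃ a ∈ s, a ≤ p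

/-- The topology on an algebraic lattice generated by the sets `↑k` and their complements, for `k`
compact. -/
abbrev compactTopology : TopologicalSpace L :=
  TopologicalSpace.generateFrom
    ({U | ∃ k : L, IsCompactElement k ∧ U = Set.Ici k} ∪
      {U | ∃ k : L, IsCompactElement k ∧ U = (Set.Ici k)ᶜ})

/-- The set of pseudoprime elements, with the order of `L`. -/
abbrev PP : Type u := {p : L // IsPseudoprime p}

/-- The subspace topology. -/
instance : TopologicalSpace (PP L) :=
  TopologicalSpace.induced Subtype.val (compactTopology L)

/-- The (meet-)prime elements, as a subset of the pseudoprime elements. -/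
def PP.primes : Set (PP L) := {p | InfPrime p.1}

variable {L} {M : Type u} [CompleteLattice M]

/-- The right adjoint of a join-preserving map. -/
def rightAdj (α : AlgLatHom L M) (p : M) : L := sSup {a | α.toFun a ≤ p}

theorem gc_rightAdj (α : AlgLatHom L M) : GaloisConnection α.toFun (rightAdj α) := by
  intro a p
  refine ⟨fun h => le_sSup h, fun h => ?_⟩
  have hmono : α.toFun a ≤ α.toFun (rightAdj α p) := by
    have h2 := α.map_sSup {a, rightAdj α p}
    rw [Set.image_pair, sSup_pair, sSup_pair, sup_eq_right.2 h] at h2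
    rw [h2]
    exact le_sup_left
  refine hmono.trans ?_
  rw [rightAdj, α.map_sSup]
  apply sSup_le
  rintro _ ⟨b, hb, rfl⟩
  exact hb

/-- `p R_α q` iff `r(p) ≤ q`, where `r` is the right adjoint of `α`. -/
def ppRel (α : AlgLatHom L M) : PP M → PP L → Prop := fun p q => rightAdj α p.1 ≤ q.1

end Pseudoprime

/-- `L ↦ ⟨PP(L), τ, ≤, P(L)⟩`, `α ↦ R_α` is contravariantly functorial, with values in generalized
Priestley spaces. -/
structure PPWellDefined : Prop where
  isGPS : ∀ L : KAlgFrmJ.{u}, IsGPS (PP L.obj) (PP.primes L.obj)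
  isGPMorphism : ∀ {L M : KAlgFrmJ.{u}} (α : L ⟶ M),
    IsGPMorphism (PP.primes M.obj) (PP.primes L.obj) (ppRel (KAlgFrmJ.toHom α))
  map_comp : ∀ {L M N : KAlgFrmJ.{u}} (α : L ⟶ M) (β : M ⟶ N),
    ppRel (KAlgFrmJ.toHom (α ≫ β)) =
      relComp (PP.primes L.obj) (ppRel (KAlgFrmJ.toHom β)) (ppRel (KAlgFrmJ.toHom α))

/-- The contravariant functor `𝒴`. -/
def ppFunctor (h : PPWellDefined.{u}) : KAlgFrmJ.{u} ⥤ GPS.{u}ᵒᵖ where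
  obj L := op ⟨PP L.obj, PP.primes L.obj, h.isGPS L⟩
  map α := Quiver.Hom.op (V := GPS.{u}) ⟨ppRel (KAlgFrmJ.toHom α), h.isGPMorphism α⟩
  map_id L := by
    apply Quiver.Hom.unop_inj
    apply GPSHom.ext
    funext p q
    have : rightAdj (KAlgFrmJ.toHom (𝟙 L)) p.1 = p.1 :=
      le_antisymm (sSup_le fun _ h => h) (le_sSup (le_refl p.1))
    exact congrArg (· ≤ q.1) this
  map_comp α β := by
    apply Quiver.Hom.unop_inj
    apply GPSHom.ext
    exact h.map_comp α β

end GenPriestley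

open GenPriestley

/-! The algebraic half is ideal completion in dual form. The compact filters of `M` are the
principal ones, and an algebraic lattice is the filter lattice of the dual of its compact elements.
Under this correspondence distributivity of `M` is the frame law, and a bottom of `M` is compactness
of the top.

The topological half rests on `isAdmissible_pp_iff`: the admissible clopen upsets of `PP L` are
exactly the sets `↑k` with `k` compact. The primes needed come from Zorn's lemma
(`exists_infPrime_of_not_le`), and compactness of `PP L` comes from pseudoprimeness being
expressible by compact elements alone (`isPseudoprime_iff`). With `box_ppRel` this gives `𝒦 ≅ 𝒜 ∘
𝒴`. On the side of spaces, the compact elements of `𝒱ᵃ(X)` are the admissible clopen upsets, so `𝒜 ≅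
𝒦 ∘ 𝒱ᵃ`.

The functor `𝒜` is faithful because a morphism is determined by its boxes, full because a
semilattice map `f` is the box of the relation it induces (`box_admRel`), and essentially surjective
because `M ≅ 𝒦(ℱ M) ≅ 𝒜(𝒴(ℱ M))`. The other dual equivalences arise by composing this one with `ℱ`
and `𝒦` and replacing functors by isomorphic ones.

For `𝒳`, the envelope is realized by sets of prime filters. There `e a ≤ ⋁ e b` over `b ∈ s` holds
iff `a` lies below every upper bound of `s`, that is, iff `⋂ ↑b ⊆ ↑a`. This turns optimality into
pseudoprimeness, so the space of optimal filters inherits everything from `PP (Filt M)`. -/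

namespace GenPriestley

/-! ### Compact elements -/

section CompactElements

theorem isCompactElement_orderIso {L M : Type u} [CompleteLattice L] [CompleteLattice M]
    (e : L ≃o M) {k : L} (hk : IsCompactElement k) : IsCompactElement (e k) := by
  intro s v hs hd hv hle
  obtain ⟨x, ⟨y, hy, rfl⟩, hx⟩ := hk (e.symm '' s) (e.symm v) (hs.image _)
    (hd.mono_comp fun _ _ h => e.symm.monotone h) ((OrderIso.isLUB_image' e.symm).2 hv)
    ((e.le_symm_apply).2 hle)
  exact ⟨y, hy, (e.le_symm_apply).1 hx⟩

variable {L : Type u} [CompleteLattice L]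

theorem directedOn_compact_le (b : L) : DirectedOn (· ≤ ·) {c : L | IsCompactElement c ∧ c ≤ b} :=
  fun x hx y hy => ⟨x ⊔ y, ⟨isCompactElement_sup' hx.1 hy.1, sup_le hx.2 hy.2⟩,
    le_sup_left, le_sup_right⟩

theorem compact_le_nonempty (b : L) : {c : L | IsCompactElement c ∧ c ≤ b}.Nonempty :=
  ⟨⊥, isCompactElement_bot', bot_le⟩

theorem exists_compact_of_not_le [IsCompactlyGenerated L] {a b : L} (h : ¬ a ≤ b) :
    ∃ k, IsCompactElement k ∧ k ≤ a ∧ ¬ k ≤ b := by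
  rw [le_iff_compact_le_imp] at h
  push Not at h
  exact h

end CompactElements

/-! ### Isomorphisms from order isomorphisms -/

/-- The morphism underlying an order isomorphism. -/
def AlgLatHom.ofOrderIso {L M : Type u} [CompleteLattice L] [CompleteLattice M] (e : L ≃o M) :
    AlgLatHom L M where
  toFun := e
  map_sSup S := by rw [e.map_sSup, sSup_image]
  map_compact _ hk := isCompactElement_orderIso e hk

/-- Isomorphisms of compact algebraic frames from order isomorphisms. -/
def KAlgFrmJ.isoMk {L M : KAlgFrmJ.{u}} (e : L.obj ≃o M.obj) : L ≅ M where
  hom := ⟨AlgLatHom.ofOrderIso e⟩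
  inv := ⟨AlgLatHom.ofOrderIso e.symm⟩
  hom_inv_id := by
    apply InducedCategory.hom_ext
    apply AlgLatHom.ext
    funext x
    exact e.symm_apply_apply x
  inv_hom_id := by
    apply InducedCategory.hom_ext
    apply AlgLatHom.ext
    funext x
    exact e.apply_symm_apply x

/-- Isomorphisms of bounded distributive meet-semilattices from order isomorphisms. -/
def BDMS.isoMk {M N : BDMS.{u}} (e : M.obj ≃o N.obj) : M ≅ N :=
  isBDMS.isoMk (SemilatInfCat.Iso.mk e)

/-! ### The lattice of filters -/

section FilterLattice

variable {M N : Type u} [SemilatticeInf M] [OrderTop M] [SemilatticeInf N] [OrderTop N]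

theorem mem_pfilter_inf {F G : PFilter M} {a : M} : a ∈ F ⊓ G ↔ a ∈ F ∧ a ∈ G :=
  ⟨fun h => ⟨h F (Or.inl rfl), h G (Or.inr rfl)⟩, fun h H hH => by
    rcases hH with rfl | rfl
    exacts [h.1, h.2]⟩

/-- The filter `T` is the Heyting implication from `F` to the join of the `F ⊓ s`; it contains every
member of `S`, hence `sSup S`. Distributivity makes `T` closed under meets: an element of `F` above
`c ⊓ c'` splits into factors above `c` and `c'`, both again in `F`. -/
theorem isFrameLattice_pfilter (hM : IsDistributiveMeetSemilattice M) :
    IsFrameLattice (PFilter M) := by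
  intro F S
  apply le_antisymm
  · let T : PFilter M := (IsPFilter.of_def
      (F := {c : M | ∀ d, c ≤ d → d ∈ F → d ∈ sSup ((fun s => F ⊓ s) '' S)})
      ⟨⊤, fun d hd _ => top_le_iff.1 hd ▸ PFilter.top_mem⟩
      (fun c hc c' hc' => ⟨c ⊓ c', fun d hd hdF => by
        obtain ⟨d₁, d₂, h₁, h₂, rfl⟩ := hM _ _ _ hd
        exact PFilter.inf_mem (hc d₁ h₁ (PFilter.mem_of_le inf_le_left hdF))
          (hc' d₂ h₂ (PFilter.mem_of_le inf_le_right hdF)), inf_le_left, inf_le_right⟩)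
      (fun hcc' hc d hd hdF => hc d (hcc'.trans hd) hdF)).toPFilter
    have hT : sSup S ≤ T := sSup_le fun G hG c hc d hd hdF =>
      (le_sSup (Set.mem_image_of_mem _ hG) : F ⊓ G ≤ _)
        (mem_pfilter_inf.2 ⟨hdF, PFilter.mem_of_le hd hc⟩)
    exact fun a ha => hT (mem_pfilter_inf.1 ha).2 a le_rfl (mem_pfilter_inf.1 ha).1
  · apply sSup_le
    rintro _ ⟨G, hG, rfl⟩
    exact inf_le_inf_left _ (le_sSup hG)

/-- A directed union of filters is a filter, so directed joins are unions. -/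
theorem exists_mem_of_mem_isLUB {S : Set (PFilter M)} (hS : S.Nonempty)
    (hd : DirectedOn (· ≤ ·) S) {G : PFilter M} (hG : IsLUB S G) {a : M} (ha : a ∈ G) :
    ∃ F ∈ S, a ∈ F := by
  let T : PFilter M := (IsPFilter.of_def (F := {c : M | ∃ F ∈ S, c ∈ F})
    (hS.elim fun F hF => ⟨⊤, F, hF, PFilter.top_mem⟩)
    (fun c ⟨F, hF, hc⟩ c' ⟨F', hF', hc'⟩ => by
      obtain ⟨H, hH, h, h'⟩ := hd F hF F' hF'
      exact ⟨c ⊓ c', ⟨H, hH, PFilter.inf_mem (h hc) (h' hc')⟩, inf_le_left, inf_le_right⟩)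
    (fun hcc' ⟨F, hF, hc⟩ => ⟨F, hF, PFilter.mem_of_le hcc' hc⟩)).toPFilter
  have hT : T ∈ upperBounds S := fun F hF c hc => ⟨F, hF, hc⟩
  exact hG.2 hT ha

theorem isCompactElement_principal (a : M) : IsCompactElement (PFilter.principal a) := by
  intro S G hS hd hG hle
  obtain ⟨F, hF, ha⟩ := exists_mem_of_mem_isLUB hS hd hG (PFilter.principal_le_iff.1 hle)
  exact ⟨F, hF, PFilter.principal_le_iff.2 ha⟩

theorem sSup_principal_image (F : PFilter M) : sSup (PFilter.principal '' (F : Set M)) = F := by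
  apply le_antisymm
  · apply sSup_le
    rintro _ ⟨a, ha, rfl⟩
    exact PFilter.principal_le_iff.2 ha
  · exact fun a ha => (le_sSup (Set.mem_image_of_mem _ ha) : PFilter.principal a ≤ _) le_rfl

/-- A filter is the directed join of the principal filters of its members; if it is compact, one of
these is already everything. -/
theorem isCompactElement_pfilter_iff {F : PFilter M} :
    IsCompactElement F ↔ ∃ a, PFilter.principal a = F := by
  refine ⟨fun h => ?_, fun ⟨a, ha⟩ => ha ▸ isCompactElement_principal a⟩
  obtain ⟨_, ⟨a, ha, rfl⟩, hle⟩ := h (PFilter.principal '' (F : Set M)) F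
    (F.nonempty.image _) (by
      rintro _ ⟨a, ha, rfl⟩ _ ⟨b, hb, rfl⟩
      exact ⟨_, ⟨a ⊓ b, PFilter.inf_mem ha hb, rfl⟩, PFilter.antitone_principal inf_le_left,
        PFilter.antitone_principal inf_le_right⟩)
    (isLUB_iff_sSup_eq.2 (sSup_principal_image F)) le_rfl
  exact ⟨a, le_antisymm (PFilter.principal_le_iff.2 ha) hle⟩

theorem isCompactlyGenerated_pfilter : IsCompactlyGenerated (PFilter M) :=
  ⟨fun F => ⟨PFilter.principal '' (F : Set M), by
    rintro _ ⟨a, -, rfl⟩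
    exact isCompactElement_principal a, sSup_principal_image F⟩⟩

theorem isCompactElement_top_pfilter {b : M} (hb : ∀ a, b ≤ a) :
    IsCompactElement (⊤ : PFilter M) :=
  isCompactElement_pfilter_iff.2 ⟨b, top_le_iff.1 fun a _ => hb a⟩

/-- The preimage of a filter. -/
def filterComap (α : InfTopHom M N) (G : PFilter N) : PFilter M :=
  (IsPFilter.of_def (F := {a : M | α a ∈ G}) ⟨⊤, by
      change α ⊤ ∈ G
      rw [map_top]
      exact PFilter.top_mem⟩
    (fun a ha b hb => ⟨a ⊓ b, by
      change α (a ⊓ b) ∈ G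
      rw [map_inf]
      exact PFilter.inf_mem ha hb, inf_le_left, inf_le_right⟩)
    (fun hab ha => PFilter.mem_of_le (OrderHomClass.mono α hab) ha)).toPFilter

/-- As a left adjoint, `filterMap α` preserves joins. -/
theorem gc_filterMap (α : InfTopHom M N) : GaloisConnection (filterMap α) (filterComap α) := by
  intro F G
  refine ⟨fun h a ha => h ⟨a, ha, le_rfl⟩, ?_⟩
  rintro h b ⟨a, ha, hab⟩
  exact PFilter.mem_of_le hab (h ha)

theorem filterMap_principal (α : InfTopHom M N) (a : M) :
    filterMap α (PFilter.principal a) = PFilter.principal (α a) :=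
  le_antisymm (fun _ ⟨_, ha', hb⟩ => (OrderHomClass.mono α ha').trans hb)
    (PFilter.principal_le_iff.2 ⟨a, le_rfl, le_rfl⟩)

/-- A meet-semilattice is dual to the compact elements of its lattice of filters. -/
noncomputable def principalIso (M : Type u) [SemilatticeInf M] [OrderTop M] :
    M ≃o CompactsDual (PFilter M) where
  toEquiv := Equiv.ofBijective
    (fun a => OrderDual.toDual ⟨PFilter.principal a, isCompactElement_principal a⟩)
    ⟨fun a b h => by
      have h' : PFilter.principal a = PFilter.principal b := congrArg (fun k => k.1) h
      exact le_antisymm (PFilter.principal_le_principal_iff.1 h'.ge)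
        (PFilter.principal_le_principal_iff.1 h'.le), fun k => by
      obtain ⟨a, ha⟩ := isCompactElement_pfilter_iff.1 k.2
      exact ⟨a, Subtype.ext ha⟩⟩
  map_rel_iff' := PFilter.principal_le_principal_iff

end FilterLattice

theorem filterWellDefined : FilterWellDefined.{u} where
  algebraic _ := isCompactlyGenerated_pfilter
  isKAlgFrm M := ⟨isFrameLattice_pfilter M.2.1,
    M.2.2.elim fun _ hb => isCompactElement_top_pfilter hb⟩
  map_sSup α S := by rw [(gc_filterMap (BDMS.toHom α)).l_sSup, sSup_image]
  map_compact α F hF := by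
    obtain ⟨a, rfl⟩ := isCompactElement_pfilter_iff.1 hF
    rw [filterMap_principal]
    exact isCompactElement_principal _

/-! ### The semilattice of compact elements -/

section CompactSemilattice

variable {L : Type u} [CompleteLattice L]

/-- In the order of `L`, a compact `c ≤ a ⊔ b` has to be split as `k ⊔ l` with compact `k ≤ a` and
`l ≤ b`. The frame law gives `c = (c ⊓ a) ⊔ (c ⊓ b)`; approximating both parts by compact elements
yields the directed set `S`, and compactness of `c` selects one member. -/
theorem isDistributive_compactsDual [IsCompactlyGenerated L] (hL : IsFrameLattice L) :
    IsDistributiveMeetSemilattice (CompactsDual L) := by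
  intro a b c habc
  have hle : c.1 ≤ a.1 ⊔ b.1 := habc
  let S : Set L := {x | ∃ k l : L, IsCompactElement k ∧ IsCompactElement l ∧
    k ≤ c.1 ⊓ a.1 ∧ l ≤ c.1 ⊓ b.1 ∧ k ⊔ l = x}
  have hinf : c.1 ≤ (c.1 ⊓ a.1) ⊔ (c.1 ⊓ b.1) := by
    have := hL c.1 {a.1, b.1}
    rw [sSup_pair, Set.image_pair, sSup_pair, inf_eq_left.2 hle] at this
    exact this.le
  have hS : c.1 ≤ sSup S := by
    refine hinf.trans (sup_le ?_ ?_)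
    · rw [← sSup_compact_le_eq (c.1 ⊓ a.1)]
      exact sSup_le fun k hk => le_sSup ⟨k, ⊥, hk.1, isCompactElement_bot', hk.2, bot_le, by simp⟩
    · rw [← sSup_compact_le_eq (c.1 ⊓ b.1)]
      exact sSup_le fun k hk => le_sSup ⟨⊥, k, isCompactElement_bot', hk.1, bot_le, hk.2, by simp⟩
  obtain ⟨_, ⟨k, l, hk, hl, hka, hlb, rfl⟩, hc⟩ := c.2 S _
    ⟨_, ⊥, ⊥, isCompactElement_bot', isCompactElement_bot', bot_le, bot_le, rfl⟩ (by
      rintro _ ⟨k, l, hk, hl, hka, hlb, rfl⟩ _ ⟨k', l', hk', hl', hka', hlb', rfl⟩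
      exact ⟨_, ⟨k ⊔ k', l ⊔ l', isCompactElement_sup' hk hk', isCompactElement_sup' hl hl',
        sup_le hka hka', sup_le hlb hlb', rfl⟩, sup_le_sup le_sup_left le_sup_left,
        sup_le_sup le_sup_right le_sup_right⟩) (isLUB_sSup S) hS
  exact ⟨OrderDual.toDual ⟨k, hk⟩, OrderDual.toDual ⟨l, hl⟩, hka.trans inf_le_right,
    hlb.trans inf_le_right, Subtype.ext
      (le_antisymm (sup_le (hka.trans inf_le_left) (hlb.trans inf_le_left)) hc)⟩

/-- The filter of compact elements below `x`. -/
def compactFilter (x : L) : PFilter (CompactsDual L) :=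
  (IsPFilter.of_def (F := {k : CompactsDual L | k.1 ≤ x}) ⟨⊤, (bot_le : (⊥ : L) ≤ x)⟩
    (fun _ hk _ hl => ⟨_, sup_le hk hl, inf_le_left, inf_le_right⟩)
    (fun {k l} (hkl : l.1 ≤ k.1) (hk : k.1 ≤ x) => hkl.trans hk)).toPFilter

/-- An algebraic lattice is the lattice of filters of the dual of its compact elements. -/
def compactFilterIso (L : Type u) [CompleteLattice L] [IsCompactlyGenerated L] :
    L ≃o PFilter (CompactsDual L) where
  toFun := compactFilter
  invFun G := sSup ((fun k : CompactsDual L => k.1) '' (G : Set (CompactsDual L)))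
  left_inv x := by
    apply le_antisymm
    · apply sSup_le
      rintro _ ⟨k, hk, rfl⟩
      exact hk
    · refine (sSup_compact_le_eq x).ge.trans (sSup_le fun k hk => le_sSup ?_)
      exact ⟨OrderDual.toDual ⟨k, hk.1⟩, hk.2, rfl⟩
  right_inv G := by
    apply SetLike.ext
    intro k
    refine ⟨fun hk => ?_, fun hk => le_sSup ⟨k, hk, rfl⟩⟩
    obtain ⟨_, ⟨l, hl, rfl⟩, hkl⟩ := k.2 _ _ (G.nonempty.image _) (by
      rintro _ ⟨a, ha, rfl⟩ _ ⟨b, hb, rfl⟩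
      exact ⟨_, ⟨a ⊓ b, PFilter.inf_mem ha hb, rfl⟩, (inf_le_left : a ⊓ b ≤ a),
        (inf_le_right : a ⊓ b ≤ b)⟩) (isLUB_sSup _) hk
    exact PFilter.mem_of_le (show l ≤ k from hkl) hl
  map_rel_iff' {x y} := by
    refine ⟨fun h => ?_, fun h k hk => le_trans hk h⟩
    refine le_iff_compact_le_imp.2 fun k hk hkx => ?_
    exact h (show OrderDual.toDual ⟨k, hk⟩ ∈ compactFilter x from hkx)

end CompactSemilattice

theorem compactWellDefined : CompactWellDefined.{u} := fun L =>
  ⟨isDistributive_compactsDual L.2.1, OrderDual.toDual ⟨⊤, L.2.2⟩, fun a => (le_top : a.1 ≤ ⊤)⟩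

/-- `M ≅ K(Filt(M))`. -/
noncomputable def filterUnitIso (hF : FilterWellDefined.{u}) (hK : CompactWellDefined.{u}) :
    𝟭 BDMS.{u} ≅ filterFunctor hF ⋙ compactFunctor hK :=
  NatIso.ofComponents (fun M => BDMS.isoMk (principalIso M.obj)) fun {M N} α => by
    apply InducedCategory.hom_ext
    apply InfTopHom.ext
    intro a
    apply Subtype.ext
    exact (filterMap_principal (BDMS.toHom α) a).symm

/-- `L ≅ Filt(K(L))`. -/
noncomputable def filterCounitIso (hF : FilterWellDefined.{u}) (hK : CompactWellDefined.{u}) :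
    𝟭 KAlgFrmJ.{u} ≅ compactFunctor hK ⋙ filterFunctor hF :=
  NatIso.ofComponents (fun L => KAlgFrmJ.isoMk (compactFilterIso L.obj.carrier)) fun {L M} α => by
    apply InducedCategory.hom_ext
    apply AlgLatHom.ext
    funext x
    apply SetLike.ext (A := PFilter (CompactsDual M.obj))
    intro k
    change k.1 ≤ (KAlgFrmJ.toHom α).toFun x ↔
      ∃ l : CompactsDual L.obj, l.1 ≤ x ∧ k.1 ≤ (KAlgFrmJ.toHom α).toFun l.1
    have hmono : Monotone (KAlgFrmJ.toHom α).toFun := (gc_rightAdj (KAlgFrmJ.toHom α)).monotone_l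
    refine ⟨fun h => ?_, fun ⟨l, hl, hk⟩ => hk.trans (hmono hl)⟩
    rw [← sSup_compact_le_eq x, AlgLatHom.map_sSup] at h
    obtain ⟨_, ⟨l, hl, rfl⟩, hkl⟩ := k.2 _ _ ((compact_le_nonempty x).image _)
      ((directedOn_compact_le x).mono_comp fun _ _ h => hmono h) (isLUB_sSup _) h
    exact ⟨OrderDual.toDual ⟨l, hl.1⟩, hl.2, hkl⟩

/-- The equivalence of bounded distributive meet-semilattices and compact algebraic frames. -/
noncomputable def filterEquivalence (hF : FilterWellDefined.{u}) (hK : CompactWellDefined.{u}) :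
    BDMS.{u} ≌ KAlgFrmJ.{u} :=
  CategoryTheory.Equivalence.mk (filterFunctor hF) (compactFunctor hK) (filterUnitIso hF hK)
    (filterCounitIso hF hK).symm

/-! ### Compact Priestley spaces -/

section Priestley

variable {X : Type u} [PartialOrder X] [TopologicalSpace X] [PriestleySpace X]

theorem isClosed_Ici_of_priestley (x : X) : IsClosed (Set.Ici x) := by
  rw [← isOpen_compl_iff, isOpen_iff_mem_nhds]
  intro y hy
  obtain ⟨U, hU, hup, hxU, hyU⟩ := exists_isClopen_upper_of_not_le hy
  exact Filter.mem_of_superset (hU.compl.isOpen.mem_nhds hyU) fun z hz hxz => hz (hup hxz hxU)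

/-- Zorn's lemma: for a chain in `C`, the sets `↑a ∩ C` are nonempty, closed and directed, so by
compactness they have a common point, which bounds the chain. -/
theorem exists_le_maximal_of_isClosed [CompactSpace X] {C : Set X} (hC : IsClosed C) {x : X}
    (hx : x ∈ C) : ∃ m, x ≤ m ∧ Maximal (· ∈ C) m := by
  refine zorn_le_nonempty₀ C (fun c hcC hc y hy => ?_) x hx
  have : Nonempty c := ⟨⟨y, hy⟩⟩
  have hcl : ∀ a : c, IsClosed (Set.Ici a.1 ∩ C) := fun a =>
    (isClosed_Ici_of_priestley a.1).inter hC
  obtain ⟨z, hz⟩ := IsCompact.nonempty_iInter_of_directed_nonempty_isCompact_isClosed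
    (fun a : c => Set.Ici a.1 ∩ C) (fun a b => by
      rcases hc.total a.2 b.2 with h | h
      · exact ⟨b, Set.inter_subset_inter_left _ (Set.Ici_subset_Ici.2 h), subset_rfl⟩
      · exact ⟨a, subset_rfl, Set.inter_subset_inter_left _ (Set.Ici_subset_Ici.2 h)⟩)
    (fun a => ⟨a.1, le_rfl, hcC a.2⟩) (fun a => (hcl a).isCompact) hcl
  rw [Set.mem_iInter] at hz
  exact ⟨z, (hz ⟨y, hy⟩).2, fun a ha => (hz ⟨a, ha⟩).1⟩

end Priestley

/-! ### Prime and pseudoprime elements -/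

section PseudoprimeElements

variable {L : Type u} [CompleteLattice L]

theorem IsFrameLattice.sup_inf_sup_le (hL : IsFrameLattice L) (m a b : L) :
    (m ⊔ a) ⊓ (m ⊔ b) ≤ m ⊔ a ⊓ b := by
  have key : ∀ x y z : L, x ⊓ (y ⊔ z) = x ⊓ y ⊔ x ⊓ z := fun x y z => by
    have := hL x {y, z}
    rwa [sSup_pair, Set.image_pair, sSup_pair] at this
  rw [key, inf_comm _ b, key]
  exact sup_le (inf_le_right.trans le_sup_left)
    (sup_le (inf_le_right.trans le_sup_left) (inf_comm b a ▸ le_sup_right))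

/-- Compactness of `k` lets Zorn's lemma produce `m ≥ b` maximal among the elements not above `k`.
If `a, c ≰ m`, then `m ⊔ a` and `m ⊔ c` are above `k`, hence so is `m ⊔ a ⊓ c`, and `a ⊓ c ≰ m`. -/
theorem exists_infPrime_of_not_le (hL : IsFrameLattice L) {k b : L} (hk : IsCompactElement k)
    (hkb : ¬ k ≤ b) : ∃ p, InfPrime p ∧ b ≤ p ∧ ¬ k ≤ p := by
  obtain ⟨m, hbm, hm⟩ := zorn_le_nonempty₀ {x : L | ¬ k ≤ x} (fun c hc hch y hy =>
    ⟨sSup c, fun hle => by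
      obtain ⟨x, hx, hkx⟩ := hk c _ ⟨y, hy⟩ hch.directedOn (isLUB_sSup c) hle
      exact hc hx hkx, fun z hz => le_sSup hz⟩) b hkb
  refine ⟨m, ⟨fun hmax => hm.1 (le_top.trans (isMax_iff_eq_top.1 hmax).ge), fun a c hac => ?_⟩,
    hbm, hm.1⟩
  by_contra! h
  have key : ∀ x, ¬ x ≤ m → k ≤ m ⊔ x := fun x hx => by
    by_contra hn
    exact hx (le_sup_right.trans (hm.2 hn le_sup_left))
  exact hm.1 ((le_inf (key a h.1) (key c h.2)).trans
    ((hL.sup_inf_sup_le m a c).trans (sup_le le_rfl hac)))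

/-- The topology of `PP L` has a basis of sets given by finitely many conditions. -/
theorem exists_basic_subset {O : Set (PP L)} (hO : IsOpen O) {p : PP L} (hp : p ∈ O) :
    ∃ (k : L) (s : Finset L), IsCompactElement k ∧ k ≤ p.1 ∧
      (∀ l ∈ s, IsCompactElement l ∧ ¬ l ≤ p.1) ∧
      ∀ q : PP L, k ≤ q.1 → (∀ l ∈ s, ¬ l ≤ q.1) → q ∈ O := by
  classical
  obtain ⟨V, hV, rfl⟩ := (isOpen_induced_iff (t := compactTopology L)).1 hO
  clear hO
  change TopologicalSpace.GenerateOpen _ V at hV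
  induction hV with
  | basic U hU =>
    rcases hU with ⟨k, hk, rfl⟩ | ⟨k, hk, rfl⟩
    · exact ⟨k, ∅, hk, hp, by simp, fun q hq _ => hq⟩
    · exact ⟨⊥, {k}, isCompactElement_bot', bot_le, by simpa using ⟨hk, hp⟩,
        fun q _ hq => hq k (Finset.mem_singleton_self k)⟩
  | univ => exact ⟨⊥, ∅, isCompactElement_bot', bot_le, by simp, fun q _ _ => trivial⟩
  | inter U V hU hV ihU ihV =>
    obtain ⟨k, s, hk, hkp, hs, h⟩ := ihU hp.1
    obtain ⟨l, t, hl, hlp, ht, h'⟩ := ihV hp.2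
    refine ⟨k ⊔ l, s ∪ t, isCompactElement_sup' hk hl, sup_le hkp hlp, fun x hx => ?_,
      fun q hq hst => ⟨h q (le_sup_left.trans hq) fun x hx => hst x (Finset.mem_union_left _ hx),
        h' q (le_sup_right.trans hq) fun x hx => hst x (Finset.mem_union_right _ hx)⟩⟩
    rcases Finset.mem_union.1 hx with hx | hx
    exacts [hs x hx, ht x hx]
  | sUnion S hS ih =>
    obtain ⟨U, hU, hpU⟩ := hp
    obtain ⟨k, s, hk, hkp, hs, h⟩ := ih U hU hpU
    exact ⟨k, s, hk, hkp, hs, fun q hq hq' => ⟨U, hU, h q hq hq'⟩⟩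

theorem isClopen_pp_Ici {k : L} (hk : IsCompactElement k) : IsClopen {p : PP L | k ≤ p.1} :=
  ⟨⟨(isOpen_induced_iff (t := compactTopology L)).2 ⟨(Set.Ici k)ᶜ,
      TopologicalSpace.isOpen_generateFrom_of_mem (Or.inr ⟨k, hk, rfl⟩), rfl⟩⟩,
    (isOpen_induced_iff (t := compactTopology L)).2 ⟨Set.Ici k,
      TopologicalSpace.isOpen_generateFrom_of_mem (Or.inl ⟨k, hk, rfl⟩), rfl⟩⟩

theorem isUpperSet_pp_Ici (k : L) : IsUpperSet {p : PP L | k ≤ p.1} :=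
  fun _ _ hpq hp => le_trans (show k ≤ _ from hp) hpq

variable [IsCompactlyGenerated L]

/-- A finite part of the compact elements below `b` suffices to cover `a`, and its join is the
compact interpolant. -/
theorem wayBelow_iff {a b : L} : WayBelow a b ↔ ∃ k, IsCompactElement k ∧ a ≤ k ∧ k ≤ b := by
  constructor
  · intro h
    obtain ⟨T, hT, haT⟩ := h _ (sSup_compact_le_eq b).ge
    rw [← Finset.sup_id_eq_sSup] at haT
    exact ⟨T.sup id, CompleteLattice.isCompactElement_finsetSup T fun x hx => (hT hx).1, haT,
      Finset.sup_le fun x hx => (hT hx).2⟩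
  · rintro ⟨k, hk, hak, hkb⟩ S hS
    obtain ⟨T, hT, hkT⟩ :=
      (CompleteLattice.isCompactElement_iff_exists_le_sSup_of_le_sSup L k).1 hk S
        (hkb.trans hS)
    rw [Finset.sup_id_eq_sSup] at hkT
    exact ⟨T, hT, hak.trans hkT⟩

/-- Any member of `s` not below `p` may be shrunk to a compact element not below `p`, so compact
members suffice. Every condition is then a subbasic clopen one, hence stable under limits. -/
theorem isPseudoprime_iff {p : L} :
    IsPseudoprime p ↔ p ≠ ⊤ ∧ ∀ (s : Finset L) (k : L), (∀ a ∈ s, IsCompactElement a) →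
      IsCompactElement k → k ≤ p → s.inf id ≤ k → ∃ a ∈ s, a ≤ p := by
  classical
  refine and_congr_right fun _ => ⟨fun h s k _ hk hkp hsk => h s (wayBelow_iff.2 ⟨k, hk, hsk, hkp⟩),
    fun h s hs => ?_⟩
  obtain ⟨k, hk, hsk, hkp⟩ := wayBelow_iff.1 hs
  by_contra! hn
  choose f hf using fun a : s => exists_compact_of_not_le (hn a.1 a.2)
  obtain ⟨b, hb, hbp⟩ := h (s.attach.image f) k (fun b hb => by
    obtain ⟨a, -, rfl⟩ := Finset.mem_image.1 hb
    exact (hf a).1) hk hkp ((Finset.le_inf fun a ha =>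
      (Finset.inf_le (Finset.mem_image_of_mem f (Finset.mem_attach s ⟨a, ha⟩))).trans
        (hf ⟨a, ha⟩).2.1).trans hsk)
  obtain ⟨a, -, rfl⟩ := Finset.mem_image.1 hb
  exact (hf a).2.2 hbp

theorem isPseudoprime_of_infPrime {p : L} (hp : InfPrime p) : IsPseudoprime p :=
  isPseudoprime_iff.2 ⟨hp.ne_top, fun _ _ _ _ hkp hsk => hp.finset_inf_le.1 (hsk.trans hkp)⟩

theorem exists_prime_pp_of_not_le (hL : IsFrameLattice L) {a b : L} (h : ¬ a ≤ b) :
    ∃ p : PP L, p ∈ PP.primes L ∧ b ≤ p.1 ∧ ¬ a ≤ p.1 := by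
  obtain ⟨k, hk, hka, hkb⟩ := exists_compact_of_not_le h
  obtain ⟨p, hp, hbp, hkp⟩ := exists_infPrime_of_not_le hL hk hkb
  exact ⟨⟨p, isPseudoprime_of_infPrime hp⟩, hp, hbp, fun h => hkp (hka.trans h)⟩

/-- The limit of an ultrafilter is the join of the compact elements lying below almost all points. A
compact element is below this join iff it is below almost all points, so pseudoprimeness passes to
the limit; compactness of `⊤` keeps the limit proper. -/
theorem compactSpace_pp (htop : IsCompactElement (⊤ : L)) : CompactSpace (PP L) := by
  refine ⟨isCompact_iff_ultrafilter_le_nhds.2 fun 𝒰 _ => ?_⟩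
  let A : Set L := {k | IsCompactElement k ∧ ∀ᶠ q : PP L in 𝒰, k ≤ q.1}
  have hA : DirectedOn (· ≤ ·) A := fun k hk l hl =>
    ⟨k ⊔ l, ⟨isCompactElement_sup' hk.1 hl.1, by
      filter_upwards [hk.2, hl.2] with q h h' using sup_le h h'⟩, le_sup_left, le_sup_right⟩
  have hAne : A.Nonempty := ⟨⊥, isCompactElement_bot', by simp⟩
  have hmem : ∀ {k : L}, IsCompactElement k → (k ≤ sSup A ↔ ∀ᶠ q : PP L in 𝒰, k ≤ q.1) := by
    intro k hk
    refine ⟨fun h => ?_, fun h => le_sSup ⟨hk, h⟩⟩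
    obtain ⟨l, hl, hkl⟩ := hk A _ hAne hA (isLUB_sSup A) h
    filter_upwards [hl.2] with q hq using hkl.trans hq
  have hpp : IsPseudoprime (sSup A) := by
    refine isPseudoprime_iff.2 ⟨fun h => ?_, fun s k hs hk hkA hsk => ?_⟩
    · obtain ⟨q, hq⟩ := ((hmem htop).1 h.ge).exists
      exact q.2.1 (top_le_iff.1 hq)
    · by_contra! hn
      have h₁ : ∀ᶠ q : PP L in 𝒰, ∀ a ∈ s, ¬ a ≤ q.1 :=
        (Filter.eventually_all_finset s).2 fun a ha =>
          Ultrafilter.eventually_not.2 fun h => hn a ha ((hmem (hs a ha)).2 h)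
      obtain ⟨q, hkq, hq⟩ := (((hmem hk).1 hkA).and h₁).exists
      obtain ⟨a, ha, haq⟩ := (isPseudoprime_iff.1 q.2).2 s k hs hk hkq hsk
      exact hq a ha haq
  refine ⟨⟨sSup A, hpp⟩, Set.mem_univ _, fun V hV => ?_⟩
  obtain ⟨O, hOV, hO, hpO⟩ := mem_nhds_iff.1 hV
  obtain ⟨k, s, hk, hkp, hs, h⟩ := exists_basic_subset hO hpO
  have h₁ : ∀ᶠ q : PP L in 𝒰, ∀ a ∈ s, ¬ a ≤ q.1 :=
    (Filter.eventually_all_finset s).2 fun a ha =>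
      Ultrafilter.eventually_not.2 fun h => (hs a ha).2 ((hmem (hs a ha).1).2 h)
  filter_upwards [(hmem hk).1 hkp, h₁] with q hkq hq using hOV (h q hkq hq)

theorem priestleySpace_pp : PriestleySpace (PP L) := ⟨fun {p q} h => by
  obtain ⟨k, hk, hkp, hkq⟩ := exists_compact_of_not_le h
  exact ⟨_, isClopen_pp_Ici hk, isUpperSet_pp_Ici k, hkp, hkq⟩⟩

/-- In a basic neighbourhood of `p`, given by `k ≤ q` and `l ≰ q` for `l ∈ s`, pseudoprimeness of
`p` forces `s.inf id ≰ k`. A prime above `k` but not above `s.inf id` lies in this neighbourhood. -/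
theorem dense_pp_primes (hL : IsFrameLattice L) : Dense (PP.primes L) := by
  intro p
  rw [mem_closure_iff]
  intro O hO hpO
  obtain ⟨k, s, hk, hkp, hs, h⟩ := exists_basic_subset hO hpO
  have hsk : ¬ s.inf id ≤ k := fun hsk => by
    obtain ⟨a, ha, hap⟩ := (isPseudoprime_iff.1 p.2).2 s k (fun a ha => (hs a ha).1) hk hkp hsk
    exact (hs a ha).2 hap
  obtain ⟨q, hq, hkq, hsq⟩ := exists_prime_pp_of_not_le hL hsk
  exact ⟨q, h q hkq fun l hl hlq => hsq ((Finset.inf_le hl).trans hlq), hq⟩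

/-- A clopen complement that avoids `↑a` avoids `↑k` for some compact `k ≤ a`. -/
theorem exists_compact_le_of_disjoint (htop : IsCompactElement (⊤ : L)) {U : Set (PP L)}
    (hU : IsClopen U) {a : L} (h : ∀ p, p ∉ U → ¬ a ≤ p.1) :
    ∃ k, IsCompactElement k ∧ k ≤ a ∧ ∀ p, p ∉ U → ¬ k ≤ p.1 := by
  have := compactSpace_pp htop
  have : Nonempty {k : L // IsCompactElement k ∧ k ≤ a} := (compact_le_nonempty a).to_subtype
  obtain ⟨k, hk⟩ := hU.compl.isClosed.isCompact.elim_directed_cover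
    (fun k : {k : L // IsCompactElement k ∧ k ≤ a} => {p : PP L | k.1 ≤ p.1}ᶜ)
    (fun k => (isClopen_pp_Ici k.2.1).compl.isOpen)
    (fun p hp => by
      obtain ⟨k, hk, hka, hkp⟩ := exists_compact_of_not_le (h p hp)
      exact Set.mem_iUnion.2 ⟨⟨k, hk, hka⟩, hkp⟩)
    (fun k l => ⟨⟨k.1 ⊔ l.1, isCompactElement_sup' k.2.1 l.2.1, sup_le k.2.2 l.2.2⟩,
      fun p hp hkl => hp (le_sup_left.trans (show k.1 ⊔ l.1 ≤ p.1 from hkl)),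
      fun p hp hkl => hp (le_sup_right.trans (show k.1 ⊔ l.1 ≤ p.1 from hkl))⟩)
  exact ⟨k.1, k.2.1, k.2.2, fun p hp => hk hp⟩

/-- The admissible clopen upsets of `PP L` are the sets `↑k` with `k` compact. -/
theorem isAdmissible_pp_iff (hL : IsFrameLattice L) (htop : IsCompactElement (⊤ : L))
    {U : Set (PP L)} :
    IsAdmissible (PP.primes L) U ↔ ∃ k, IsCompactElement k ∧ U = {p : PP L | k ≤ p.1} := by
  classical
  have := compactSpace_pp htop
  have := priestleySpace_pp (L := L)
  constructor
  · rintro ⟨hU, hup, hmax⟩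
    -- Since `U` is an upset, no point outside `U` is above `x`, and the preceding lemma replaces
    -- `x` by a compact element.
    have h₁ : ∀ x : U, ∃ k, IsCompactElement k ∧ k ≤ x.1.1 ∧ ∀ p, p ∉ U → ¬ k ≤ p.1 := fun x =>
      exists_compact_le_of_disjoint htop hU fun p hp hxp => hp (hup hxp x.2)
    choose f hf hfx hfU using h₁
    obtain ⟨t, ht⟩ := hU.isClosed.isCompact.elim_nhds_subcover' (fun x hx => {p | f ⟨x, hx⟩ ≤ p.1})
      fun x hx => (isClopen_pp_Ici (hf _)).isOpen.mem_nhds (hfx ⟨x, hx⟩)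
    -- The meet `t.inf f` need not be compact, but it is below no point outside `U`: such a point
    -- lies under a maximal one, which is prime by admissibility and would then be above some `f x`.
    -- A compact element under the meet therefore works.
    obtain ⟨k, hk, hkt, hkU⟩ := exists_compact_le_of_disjoint htop hU (a := t.inf f)
      fun p hp htp => by
        obtain ⟨m, hpm, hm⟩ := exists_le_maximal_of_isClosed hU.compl.isClosed hp
        obtain ⟨x, -, hx⟩ := (InfPrime.finset_inf_le (hmax hm)).1 (htp.trans hpm)
        exact hfU x m hm.1 hx
    refine ⟨k, hk, Set.Subset.antisymm (fun p hp => ?_) fun p hp => ?_⟩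
    · obtain ⟨x, hx, hxp⟩ := Set.mem_iUnion₂.1 (ht hp)
      exact (hkt.trans (Finset.inf_le hx)).trans hxp
    · by_contra hn
      exact hkU p hn hp
  · rintro ⟨k, hk, rfl⟩
    refine ⟨isClopen_pp_Ici hk, isUpperSet_pp_Ici k, fun p hp => ?_⟩
    -- A prime above `p` and not above `k` must equal `p`, by maximality.
    obtain ⟨q, hq, hpq, hkq⟩ := exists_prime_pp_of_not_le hL hp.1
    rwa [le_antisymm (show p ≤ q from hpq) (hp.2 hkq hpq)]

theorem isGPS_pp (hL : IsFrameLattice L) (htop : IsCompactElement (⊤ : L)) :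
    IsGPS (PP L) (PP.primes L) where
  compact := compactSpace_pp htop
  priestley := priestleySpace_pp
  dense := dense_pp_primes hL
  order_dense p := by
    obtain ⟨q, hq, hpq, -⟩ := exists_prime_pp_of_not_le hL (fun h => p.2.1 (top_le_iff.1 h))
    exact ⟨q, hq, hpq⟩
  -- Larger sets `↑k` belong to smaller `k`, so directedness says that two compact elements not
  -- below `p` have a common compact lower bound not below `p`: primeness tested on compact
  -- elements.
  mem_iff p := by
    have hsub : ∀ {k l : L}, {q : PP L | k ≤ q.1} ⊆ {q | l ≤ q.1} → l ≤ k := fun {k l} h => by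
      by_contra hn
      obtain ⟨q, -, hkq, hlq⟩ := exists_prime_pp_of_not_le hL hn
      exact hlq (h hkq)
    constructor
    · rintro hp U ⟨hU, hpU⟩ V ⟨hV, hpV⟩
      obtain ⟨k, hk, rfl⟩ := (isAdmissible_pp_iff hL htop).1 hU
      obtain ⟨l, hl, rfl⟩ := (isAdmissible_pp_iff hL htop).1 hV
      obtain ⟨m, hm, hmkl, hmp⟩ := exists_compact_of_not_le
        (fun h : k ⊓ l ≤ p.1 => (hp.2 h).elim hpU hpV)
      exact ⟨_, ⟨(isAdmissible_pp_iff hL htop).2 ⟨m, hm, rfl⟩, hmp⟩,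
        fun q hq => (hmkl.trans inf_le_left).trans hq,
        fun q hq => (hmkl.trans inf_le_right).trans hq⟩
    · refine fun hd => ⟨fun h => p.2.1 (isMax_iff_eq_top.1 h), fun a b hab => ?_⟩
      by_contra! hn
      obtain ⟨k, hk, hka, hkp⟩ := exists_compact_of_not_le hn.1
      obtain ⟨l, hl, hlb, hlp⟩ := exists_compact_of_not_le hn.2
      obtain ⟨W, ⟨hW, hpW⟩, hkW, hlW⟩ := hd
        {q : PP L | k ≤ q.1} ⟨(isAdmissible_pp_iff hL htop).2 ⟨k, hk, rfl⟩, hkp⟩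
        {q : PP L | l ≤ q.1} ⟨(isAdmissible_pp_iff hL htop).2 ⟨l, hl, rfl⟩, hlp⟩
      obtain ⟨m, hm, rfl⟩ := (isAdmissible_pp_iff hL htop).1 hW
      exact hpW ((le_inf ((hsub hkW).trans hka) ((hsub hlW).trans hlb)).trans hab)
  le_iff p q := by
    constructor
    · intro h U hU hp
      exact hU.2.1 h hp
    · intro h
      refine le_iff_compact_le_imp.2 fun k hk hkp => ?_
      exact h _ ((isAdmissible_pp_iff hL htop).2 ⟨k, hk, rfl⟩) hkp

variable {M : Type u} [CompleteLattice M]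

/-- By adjunction `α k ≤ p` iff `k ≤ r(p)`, and primes above `r(p)` detect whether `k ≤ r(p)`. Thus
`box` acts on the sets `↑k` as `α` acts on `k`. -/
theorem box_ppRel (hL : IsFrameLattice L) (α : AlgLatHom L M) (k : L) :
    box (ppRel α) {q : PP L | k ≤ q.1} = {p : PP M | α.toFun k ≤ p.1} := by
  ext p
  refine ⟨fun h => ?_, fun h q hq => ((gc_rightAdj α k p.1).1 h).trans hq⟩
  change α.toFun k ≤ p.1
  rw [gc_rightAdj α k p.1]
  by_contra hn
  obtain ⟨q, -, hrq, hkq⟩ := exists_prime_pp_of_not_le hL hn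
  exact hkq (h q hrq)

variable [IsCompactlyGenerated M]

theorem isGPMorphism_ppRel (hL : IsFrameLattice L) (htop : IsCompactElement (⊤ : L))
    (hM : IsFrameLattice M) (htop' : IsCompactElement (⊤ : M)) (α : AlgLatHom L M) :
    IsGPMorphism (PP.primes M) (PP.primes L) (ppRel α) where
  exists_of_not_rel p q h := by
    obtain ⟨k, hk, hkp, hkq⟩ := exists_compact_of_not_le h
    exact ⟨_, (isAdmissible_pp_iff hL htop).2 ⟨k, hk, rfl⟩, fun z hz => hkp.trans hz, hkq⟩
  box_admissible U hU := by
    obtain ⟨k, hk, rfl⟩ := (isAdmissible_pp_iff hL htop).1 hU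
    rw [box_ppRel hL]
    exact (isAdmissible_pp_iff hM htop').2 ⟨_, α.map_compact k hk, rfl⟩

end PseudoprimeElements

/-- A generalized Priestley morphism is determined by its action on admissible clopen upsets. -/
theorem IsGPMorphism.rel_iff {X Y : Type u} [PartialOrder X] [TopologicalSpace X] [PartialOrder Y]
    [TopologicalSpace Y] {X₀ : Set X} {Y₀ : Set Y} {R : X → Y → Prop} (hR : IsGPMorphism X₀ Y₀ R)
    {x : X} {y : Y} : R x y ↔ ∀ U, IsAdmissible Y₀ U → x ∈ box R U → y ∈ U := by
  refine ⟨fun h U _ hx => hx y h, fun h => ?_⟩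
  by_contra hn
  obtain ⟨U, hU, hx, hy⟩ := hR.exists_of_not_rel x y hn
  exact hy (h U hU hx)

theorem ppWellDefined : PPWellDefined.{u} where
  isGPS L := isGPS_pp L.2.1 L.2.2
  isGPMorphism {L M} α := isGPMorphism_ppRel L.2.1 L.2.2 M.2.1 M.2.2 _
  map_comp {L M N} α β := by
    funext p q
    -- Relations are compared through their boxes on the sets `↑k`; both sides give `↑β(α k)`.
    refine propext ((isGPMorphism_ppRel L.2.1 L.2.2 N.2.1 N.2.2 _).rel_iff.trans ?_)
    refine forall₂_congr fun U hU => ?_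
    obtain ⟨k, hk, rfl⟩ := (isAdmissible_pp_iff L.2.1 L.2.2).1 hU
    rw [box_ppRel L.2.1, box_ppRel L.2.1, box_ppRel M.2.1]
    rfl

/-! ### Admissible upsets of generalized Priestley spaces -/

section AdmissibleUpsets

variable {X : Type u} [PartialOrder X] [TopologicalSpace X] {X₀ : Set X}

/-- Order density puts every maximal point of `X` into `X₀`. -/
theorem isAdmissible_empty (h : IsGPS X X₀) : IsAdmissible X₀ (∅ : Set X) :=
  ⟨isClopen_empty, isUpperSet_empty, fun x hx => by
    obtain ⟨y, hy, hxy⟩ := h.order_dense x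
    rwa [le_antisymm hxy (hx.2 (Set.notMem_empty y) hxy)]⟩

theorem IsAdmissible.exists_le_notMem (h : IsGPS X X₀) {U : Set X} (hU : IsAdmissible X₀ U) {x : X}
    (hx : x ∉ U) : ∃ y ∈ X₀, x ≤ y ∧ y ∉ U := by
  have := h.compact
  have := h.priestley
  obtain ⟨m, hxm, hm⟩ := exists_le_maximal_of_isClosed hU.1.compl.isClosed hx
  exact ⟨m, hU.2.2 hm, hxm, hm.1⟩

theorem isAdmissibleClosed_sInter (h : IsGPS X X₀) {S : Set (Set X)}
    (hS : ∀ U ∈ S, IsAdmissible X₀ U) : IsAdmissibleClosed X₀ (⋂₀ S) := by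
  have hup : IsUpperSet (⋂₀ S) := isUpperSet_sInter fun U hU => (hS U hU).2.1
  refine ⟨isClosed_sInter fun U hU => (hS U hU).1.isClosed, hup, Set.Subset.antisymm ?_ ?_⟩
  · intro x hx
    rw [Set.mem_compl_iff, Set.mem_sInter] at hx
    push Not at hx
    obtain ⟨U, hU, hxU⟩ := hx
    obtain ⟨y, hy, hxy, hyU⟩ := (hS U hU).exists_le_notMem h hxU
    exact ⟨y, ⟨hy, fun hn => hyU (hn U hU)⟩, hxy⟩
  · rintro x ⟨y, hy, hxy⟩ hx
    exact hy.2 (hup hxy hx)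

theorem IsAdmissible.isAdmissibleClosed (h : IsGPS X X₀) {U : Set X} (hU : IsAdmissible X₀ U) :
    IsAdmissibleClosed X₀ U := by
  rw [← Set.sInter_singleton U]
  exact isAdmissibleClosed_sInter h fun V hV => Set.mem_singleton_iff.1 hV ▸ hU

/-- A closed upset can be separated from a point of `X₀` by an admissible clopen upset. -/
theorem exists_isAdmissible_of_notMem (h : IsGPS X X₀) {C : Set X} (hC : IsClosed C)
    (hup : IsUpperSet C) {y : X} (hy : y ∈ X₀) (hyC : y ∉ C) :
    ∃ U, IsAdmissible X₀ U ∧ C ⊆ U ∧ y ∉ U := by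
  have := h.compact
  let I := {U // IsAdmissible X₀ U ∧ y ∉ U}
  have : Nonempty I := ⟨⟨∅, isAdmissible_empty h, Set.notMem_empty y⟩⟩
  -- The admissible clopen upsets missing `y` cover `C` by `le_iff` and are directed because `y ∈
  -- X₀`, so a single one contains `C`.
  obtain ⟨U, hU⟩ := hC.isCompact.elim_directed_cover (fun U : I => U.1) (fun U => U.2.1.1.isOpen)
    (fun c hc => by
      have hcy : ¬ c ≤ y := fun hcy => hyC (hup hcy hc)
      rw [h.le_iff] at hcy
      push Not at hcy
      obtain ⟨U, hU, hcU, hyU⟩ := hcy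
      exact Set.mem_iUnion.2 ⟨⟨U, hU, hyU⟩, hcU⟩)
    (fun U V => by
      obtain ⟨W, hW, hUW, hVW⟩ := (h.mem_iff y).1 hy U.1 U.2 V.1 V.2
      exact ⟨⟨W, hW⟩, hUW, hVW⟩)
  exact ⟨U.1, U.2.1, hU, U.2.2⟩

/-- A point outside `C` lies below a point of `X₀` outside `C`, which can be separated from `C`. -/
theorem IsAdmissibleClosed.mem_iff (h : IsGPS X X₀) {C : Set X} (hC : IsAdmissibleClosed X₀ C)
    {x : X} : x ∈ C ↔ ∀ U, IsAdmissible X₀ U → C ⊆ U → x ∈ U := by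
  refine ⟨fun hx U _ hCU => hCU hx, fun hx => ?_⟩
  by_contra hn
  obtain ⟨y, hy, hxy⟩ : x ∈ {x | ∃ y ∈ X₀ \ C, x ≤ y} := hC.2.2 ▸ (show x ∈ Cᶜ from hn)
  obtain ⟨U, hU, hCU, hyU⟩ := exists_isAdmissible_of_notMem h hC.1 hC.2.1 hy.1 hy.2
  exact hyU (hU.2.1 hxy (hx U hU hCU))

theorem IsAdmissibleClosed.eq_sInter (h : IsGPS X X₀) {C : Set X} (hC : IsAdmissibleClosed X₀ C) :
    C = ⋂₀ {U | IsAdmissible X₀ U ∧ C ⊆ U} := by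
  ext x
  rw [hC.mem_iff h]
  exact ⟨fun hx U hU => hx U hU.1 hU.2, fun hx U hU hCU => hx U ⟨hU, hCU⟩⟩

theorem IsAdmissibleClosed.subset_iff {C D : Set X} (hC : IsAdmissibleClosed X₀ C)
    (hD : IsUpperSet D) : D ⊆ C ↔ ∀ y ∈ X₀, y ∈ D → y ∈ C := by
  refine ⟨fun h y _ hy => h hy, fun h x hx => ?_⟩
  by_contra hn
  obtain ⟨y, hy, hxy⟩ : x ∈ {x | ∃ y ∈ X₀ \ C, x ≤ y} := hC.2.2 ▸ (show x ∈ Cᶜ from hn)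
  exact hy.2 (h y hy.1 (hD hxy hx))

end AdmissibleUpsets

/-! ### The lattice of admissible closed upsets -/

section ClosedAdmLattice

variable {X Y Z : GPS.{u}}

/-- An admissible clopen upset as an admissible closed upset. -/
def Adm.toClosedAdm (U : Adm X) : ClosedAdm X := ⟨U.1, U.2.isAdmissibleClosed X.isGPS⟩

theorem closedAdm_le_iff {C D : ClosedAdm X} : C ≤ D ↔ ∀ y ∈ X.X₀, y ∈ D.val → y ∈ C.val :=
  C.property.subset_iff D.property.2.1

/-- The meet is the least admissible closed upset containing `C ∪ D`. It may exceed the union, but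
by separation it has no further points in `X₀`. -/
theorem mem_closedAdm_inf {C D : ClosedAdm X} {y : X} (hy : y ∈ X.X₀) :
    y ∈ (C ⊓ D).val ↔ y ∈ C.val ∨ y ∈ D.val := by
  refine ⟨fun h => ?_, fun h => h.elim (fun h => (inf_le_left : C ⊓ D ≤ C) h)
    fun h => (inf_le_right : C ⊓ D ≤ D) h⟩
  by_contra hn
  obtain ⟨U, hU, hCU, hyU⟩ := exists_isAdmissible_of_notMem X.isGPS
    (C.property.1.union D.property.1) (C.property.2.1.union D.property.2.1) hy hn
  have hle : Adm.toClosedAdm ⟨U, hU⟩ ≤ C ⊓ D :=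
    le_inf (Set.subset_union_left.trans hCU) (Set.subset_union_right.trans hCU)
  exact hyU (hle h)

theorem mem_closedAdm_sSup {S : Set (ClosedAdm X)} {x : X} :
    x ∈ (sSup S).val ↔ ∀ C ∈ S, x ∈ C.val := Set.mem_iInter₂

/-- Inclusions can be tested on `X₀`, where meets are unions and joins are intersections, so the law
becomes the one for sets. -/
theorem isFrameLattice_closedAdm : IsFrameLattice (ClosedAdm X) := by
  intro C S
  apply le_antisymm
  · refine closedAdm_le_iff.2 fun y hy h => (mem_closedAdm_inf hy).2 ?_
    by_contra! hn
    refine hn.2 (mem_closedAdm_sSup.2 fun D hD => ?_)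
    exact ((mem_closedAdm_inf hy).1 (mem_closedAdm_sSup.1 h _ ⟨D, hD, rfl⟩)).resolve_left hn.1
  · apply sSup_le
    rintro _ ⟨D, hD, rfl⟩
    exact inf_le_inf_left _ (le_sSup hD)

/-- Joins are intersections, and in a compact space an open set containing a directed intersection
of closed sets contains one of them. -/
theorem isCompactElement_toClosedAdm (U : Adm X) : IsCompactElement (Adm.toClosedAdm U) := by
  have := X.isGPS.compact
  rw [CompleteLattice.isCompactElement_iff_le_of_directed_sSup_le]
  intro S hS hd hle
  have : Nonempty S := hS.to_subtype
  obtain ⟨D, hD⟩ := exists_subset_nhds_of_compactSpace (V := fun D : S => D.1.val) (U := U.1)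
    (fun C D => by
      obtain ⟨E, hE, hCE, hDE⟩ := hd C.1 C.2 D.1 D.2
      exact ⟨⟨E, hE⟩, hCE, hDE⟩) (fun D => D.1.property.1)
    (fun x hx => U.2.1.isOpen.mem_nhds
      (hle (mem_closedAdm_sSup.2 fun C hC => Set.mem_iInter.1 hx ⟨C, hC⟩)))
  exact ⟨D.1, D.2, hD⟩

theorem sSup_toClosedAdm (C : ClosedAdm X) :
    sSup {D | ∃ U : Adm X, Adm.toClosedAdm U = D ∧ D ≤ C} = C := by
  refine le_antisymm (sSup_le ?_) ?_
  · rintro _ ⟨_, _, hD⟩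
    exact hD
  intro x hx
  rw [C.property.mem_iff X.isGPS]
  exact fun U hU hCU => mem_closedAdm_sSup.1 hx _ ⟨⟨U, hU⟩, rfl, hCU⟩

theorem isCompactElement_closedAdm_iff {C : ClosedAdm X} :
    IsCompactElement C ↔ IsAdmissible X.X₀ C.val := by
  refine ⟨fun h => ?_, fun h => isCompactElement_toClosedAdm ⟨C.val, h⟩⟩
  obtain ⟨_, ⟨U, rfl, hUC⟩, hCU⟩ := h
    {D : ClosedAdm X | ∃ U : Adm X, Adm.toClosedAdm U = D ∧ D ≤ C} _
    ⟨Adm.toClosedAdm ⊤, ⊤, rfl, Set.subset_univ C.val⟩ (by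
      rintro _ ⟨U, rfl, hU⟩ _ ⟨V, rfl, hV⟩
      exact ⟨_, ⟨U ⊓ V, rfl, Set.subset_inter hU hV⟩, Set.inter_subset_left,
        Set.inter_subset_right⟩) (isLUB_sSup _) (sSup_toClosedAdm C).ge
  rw [← le_antisymm hUC hCU]
  exact U.2

theorem isCompactlyGenerated_closedAdm : IsCompactlyGenerated (ClosedAdm X) :=
  ⟨fun C => ⟨_, by
    rintro _ ⟨U, rfl, -⟩
    exact isCompactElement_toClosedAdm U, sSup_toClosedAdm C⟩⟩

theorem isCompactElement_top_closedAdm : IsCompactElement (⊤ : ClosedAdm X) := by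
  have : (⊤ : ClosedAdm X) = Adm.toClosedAdm ⟨∅, isAdmissible_empty X.isGPS⟩ :=
    (top_le_iff.1 (Set.empty_subset _)).symm
  rw [this]
  exact isCompactElement_toClosedAdm _

theorem box_sInter {X Y : Type u} (R : X → Y → Prop) (S : Set (Set Y)) :
    box R (⋂₀ S) = ⋂₀ (box R '' S) := by
  ext x
  refine ⟨?_, fun h y hy U hU => h _ ⟨U, hU, rfl⟩ y hy⟩
  rintro h _ ⟨U, hU, rfl⟩ y hy
  exact h y hy U hU

/-- `C` is an intersection of admissible clopen upsets, and `box` commutes with intersections. -/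
theorem isAdmissibleClosed_box (R : GPSHom X Y) (C : ClosedAdm Y) :
    IsAdmissibleClosed X.X₀ (box R.rel C.val) := by
  rw [C.property.eq_sInter Y.isGPS, box_sInter]
  refine isAdmissibleClosed_sInter X.isGPS ?_
  rintro _ ⟨U, hU, rfl⟩
  exact R.isGPMorphism.box_admissible U hU.1

/-- The admissible clopen upsets are dual to the compact admissible closed upsets. -/
def admIso (X : GPS.{u}) : Adm X ≃o CompactsDual (ClosedAdm X) where
  toFun U := OrderDual.toDual ⟨Adm.toClosedAdm U, isCompactElement_toClosedAdm U⟩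
  invFun C := ⟨C.1.val, isCompactElement_closedAdm_iff.1 C.2⟩
  left_inv _ := rfl
  right_inv _ := rfl
  map_rel_iff' := Iff.rfl

end ClosedAdmLattice

theorem vietorisWellDefined : VietorisWellDefined.{u} where
  algebraic _ := isCompactlyGenerated_closedAdm
  isKAlgFrm _ := ⟨isFrameLattice_closedAdm, isCompactElement_top_closedAdm⟩
  box_mem R C := isAdmissibleClosed_box R C
  map_sSup R S := by
    apply ClosedAdm.ext
    ext x
    rw [mem_closedAdm_sSup, Set.forall_mem_image]
    exact ⟨fun h C hC y hy => mem_closedAdm_sSup.1 (h y hy) C hC,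
      fun h y hy => mem_closedAdm_sSup.2 fun C hC => h hC y hy⟩
  map_compact R C hC := isCompactElement_closedAdm_iff.2
    (R.isGPMorphism.box_admissible _ (isCompactElement_closedAdm_iff.1 hC))
  map_comp {X Y Z} R S C := by
    rw [C.property.eq_sInter Z.isGPS, box_sInter, box_sInter, box_sInter, Set.image_image]
    exact congrArg Set.sInter (Set.image_congr fun U hU => box_relComp _ _ _ hU.1)

/-! ### The semilattice of admissible clopen upsets -/

theorem IsDistributiveMeetSemilattice.of_orderIso {M N : Type u} [SemilatticeInf M]
    [SemilatticeInf N] (e : M ≃o N) (h : IsDistributiveMeetSemilattice M) :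
    IsDistributiveMeetSemilattice N := by
  intro a b c habc
  obtain ⟨a', b', ha, hb, hab⟩ := h (e.symm a) (e.symm b) (e.symm c) (by
    rw [← e.symm.map_inf]
    exact e.symm.monotone habc)
  refine ⟨e a', e b', e.symm_apply_le.1 ha, e.symm_apply_le.1 hb, ?_⟩
  rw [← e.map_inf, hab, e.apply_symm_apply]

/-- Distributivity is inherited from the frame of admissible closed upsets, whose compact elements
are the admissible clopen ones. -/
theorem admWellDefined : AdmWellDefined.{u} := fun X =>
  ⟨by
    have := isCompactlyGenerated_closedAdm (X := X)
    exact (isDistributive_compactsDual isFrameLattice_closedAdm).of_orderIso (admIso X).symm,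
    ⟨∅, isAdmissible_empty X.isGPS⟩, fun U => Set.empty_subset U.1⟩

/-- `𝒜 ≅ 𝒦 ∘ 𝒱ᵃ`. -/
def admVietorisIso (hA : AdmWellDefined.{u}) (hV : VietorisWellDefined.{u})
    (hK : CompactWellDefined.{u}) : admFunctor hA ≅ vietorisFunctor hV ⋙ compactFunctor hK :=
  NatIso.ofComponents (fun X => BDMS.isoMk (admIso X.unop)) fun {X Y} R => by
    apply InducedCategory.hom_ext
    apply InfTopHom.ext
    intro U
    rfl

/-! ### Full faithfulness of `𝒜` -/

section FullyFaithful

variable {X Y : GPS.{u}}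

theorem GPSHom.ext_box {R S : GPSHom X Y}
    (h : ∀ U, IsAdmissible Y.X₀ U → box R.rel U = box S.rel U) : R = S := by
  apply GPSHom.ext
  funext x y
  rw [R.isGPMorphism.rel_iff, S.isGPMorphism.rel_iff]
  exact propext (forall₂_congr fun U hU => by rw [h U hU])

/-- The relation induced by a homomorphism of the semilattices of admissible clopen upsets. -/
def admRel (f : InfTopHom (Adm Y) (Adm X)) (x : X) (y : Y) : Prop :=
  ∀ U : Adm Y, x ∈ (f U).1 → y ∈ U.1

/-- The image of `x` is the intersection of the `V` with `x ∈ f V`, a directed family since `f`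
preserves meets. If it lies in the open set `U`, then by compactness some such `V` does, and `x ∈ f
V ⊆ f U`. -/
theorem box_admRel (f : InfTopHom (Adm Y) (Adm X)) (U : Adm Y) :
    box (admRel f) U.1 = (f U).1 := by
  ext x
  refine ⟨fun h => ?_, fun h y hy => hy U h⟩
  have := Y.isGPS.compact
  let I := {V : Adm Y // x ∈ (f V).1}
  have : Nonempty I := ⟨⟨⊤, by
    rw [map_top]
    exact Set.mem_univ x⟩⟩
  obtain ⟨V, hV⟩ := exists_subset_nhds_of_compactSpace (V := fun V : I => V.1.1) (U := U.1)
    (fun V W => ⟨⟨V.1 ⊓ W.1, by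
      rw [map_inf]
      exact ⟨V.2, W.2⟩⟩, Set.inter_subset_left, Set.inter_subset_right⟩)
    (fun V => V.1.2.1.isClosed)
    (fun y hy => U.2.1.isOpen.mem_nhds (h y fun V hV => Set.mem_iInter.1 hy ⟨V, hV⟩))
  have hle : f V.1 ≤ f U := OrderHomClass.mono f (show V.1 ≤ U from hV)
  exact hle V.2

theorem isGPMorphism_admRel (f : InfTopHom (Adm Y) (Adm X)) :
    IsGPMorphism X.X₀ Y.X₀ (admRel f) where
  exists_of_not_rel x y h := by
    unfold admRel at h
    push Not at h
    obtain ⟨U, hx, hy⟩ := h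
    exact ⟨U.1, U.2, fun z hz => hz U hx, hy⟩
  box_admissible U hU := by
    rw [box_admRel f ⟨U, hU⟩]
    exact (f ⟨U, hU⟩).2

theorem admFunctor_faithful (hA : AdmWellDefined.{u}) : (admFunctor hA).Faithful where
  map_injective {X Y} R S h := by
    apply Quiver.Hom.unop_inj
    refine GPSHom.ext_box fun U hU => ?_
    exact congrArg (fun f => (BDMS.toHom f (⟨U, hU⟩ : Adm X.unop) : Adm Y.unop).1) h

theorem admFunctor_full (hA : AdmWellDefined.{u}) : (admFunctor hA).Full where
  map_surjective {X Y} f := by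
    refine ⟨Quiver.Hom.op (V := GPS.{u}) (X := Y.unop) (Y := X.unop)
      ⟨admRel (BDMS.toHom f), isGPMorphism_admRel _⟩, ?_⟩
    apply InducedCategory.hom_ext
    apply InfTopHom.ext
    intro U
    apply Subtype.ext
    exact box_admRel (BDMS.toHom f) U

end FullyFaithful

/-! ### The dual equivalences -/

/-- The compact elements of `L` are dual to the admissible clopen upsets of `PP L`. -/
noncomputable def compactsPPIso (L : KAlgFrmJ.{u}) (h : IsGPS (PP L.obj) (PP.primes L.obj)) :
    CompactsDual L.obj ≃o Adm ⟨PP L.obj, PP.primes L.obj, h⟩ where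
  toEquiv := Equiv.ofBijective
    (fun k => ⟨{p | k.1 ≤ p.1}, (isAdmissible_pp_iff L.2.1 L.2.2).2 ⟨k.1, k.2, rfl⟩⟩) (by
      constructor
      · intro k l hkl
        have hkl' : {p : PP L.obj | k.1 ≤ p.1} = {p | l.1 ≤ p.1} := congrArg Subtype.val hkl
        apply Subtype.ext
        by_contra hn
        rcases not_and_or.1 (fun h => hn (le_antisymm h.1 h.2)) with h | h
        · obtain ⟨p, -, hp, hp'⟩ := exists_prime_pp_of_not_le L.2.1 h
          exact hp' (hkl'.ge hp)
        · obtain ⟨p, -, hp, hp'⟩ := exists_prime_pp_of_not_le L.2.1 h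
          exact hp' (hkl'.le hp)
      · rintro ⟨U, hU⟩
        obtain ⟨k, hk, rfl⟩ := (isAdmissible_pp_iff L.2.1 L.2.2).1 hU
        exact ⟨OrderDual.toDual ⟨k, hk⟩, rfl⟩)
  map_rel_iff' {k l} := by
    refine ⟨fun h => ?_, fun h p hp => le_trans (show l.1 ≤ k.1 from h) hp⟩
    change l.1 ≤ k.1
    by_contra hn
    obtain ⟨p, -, hp, hp'⟩ := exists_prime_pp_of_not_le L.2.1 hn
    exact hp' (h hp)

/-- `𝒦 ≅ 𝒜 ∘ 𝒴`. -/
noncomputable def compactPPIso (hK : CompactWellDefined.{u}) (hY : PPWellDefined.{u})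
    (hA : AdmWellDefined.{u}) : compactFunctor hK ≅ ppFunctor hY ⋙ admFunctor hA :=
  NatIso.ofComponents (fun L => BDMS.isoMk (compactsPPIso L (hY.isGPS L))) fun {L M} α => by
    apply InducedCategory.hom_ext
    apply InfTopHom.ext
    intro k
    apply Subtype.ext
    exact (box_ppRel L.2.1 (KAlgFrmJ.toHom α) k.1).symm

/-- Essential surjectivity is `M ≅ 𝒦(ℱ M) ≅ 𝒜(𝒴(ℱ M))`; no unit on the side of spaces has to be
constructed. -/
theorem admFunctor_isEquivalence (hA : AdmWellDefined.{u}) : (admFunctor hA).IsEquivalence where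
  faithful := admFunctor_faithful hA
  full := admFunctor_full hA
  essSurj := ⟨fun M => ⟨_, ⟨((compactPPIso compactWellDefined ppWellDefined hA).app
    ((filterFunctor filterWellDefined).obj M)).symm ≪≫
      ((filterUnitIso filterWellDefined compactWellDefined).app M).symm⟩⟩⟩

/-- The dual equivalence of bounded distributive meet-semilattices and generalized Priestley
spaces, with an unspecified functor from semilattices to spaces. -/
noncomputable def admEquivalence (hA : AdmWellDefined.{u}) : BDMS.{u} ≌ GPS.{u}ᵒᵖ :=
  have := admFunctor_isEquivalence hA
  (admFunctor hA).asEquivalence.symm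

/-- `𝒜⁻¹ ∘ 𝒦 ≅ 𝒴`. -/
noncomputable def compactAdmInverseIso (hK : CompactWellDefined.{u}) (hA : AdmWellDefined.{u})
    (hY : PPWellDefined.{u}) : compactFunctor hK ⋙ (admEquivalence hA).functor ≅ ppFunctor hY :=
  Functor.isoWhiskerRight (compactPPIso hK hY hA) _ ≪≫ Functor.associator _ _ _ ≪≫
    Functor.isoWhiskerLeft (ppFunctor hY) (admEquivalence hA).counitIso ≪≫
    Functor.rightUnitor _

/-- The dual equivalence of compact algebraic frames and generalized Priestley spaces. -/
noncomputable def ppEquivalence (hF : FilterWellDefined.{u}) (hK : CompactWellDefined.{u})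
    (hA : AdmWellDefined.{u}) (hV : VietorisWellDefined.{u}) (hY : PPWellDefined.{u}) :
    KAlgFrmJ.{u} ≌ GPS.{u}ᵒᵖ :=
  -- The composite equivalence is `𝒜⁻¹ ∘ 𝒦` with inverse `ℱ ∘ 𝒜`. The former is isomorphic to `𝒴`,
  -- the latter to `ℱ ∘ 𝒦 ∘ 𝒱ᵃ ≅ 𝒱ᵃ`.
  (((filterEquivalence hF hK).symm.trans (admEquivalence hA)).changeFunctor
    (compactAdmInverseIso hK hA hY)).changeInverse
    (Functor.isoWhiskerRight (admVietorisIso hA hV hK) (filterFunctor hF) ≪≫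
      Functor.associator _ _ _ ≪≫
      Functor.isoWhiskerLeft (vietorisFunctor hV) (filterCounitIso hF hK).symm ≪≫
      Functor.rightUnitor _)

/-! ### The distributive envelope -/

section Envelope

variable {M : Type u} [SemilatticeInf M]

/-- If `a ⊓ b ≤ c` for all `b ∈ s` then `a ⊓ d ≤ c` for a common upper bound `d` of `s`. -/
theorem exists_inf_le_of_forall_inf_le (hM : IsDistributiveMeetSemilattice M) {a c : M}
    (s : Finset M) (h : ∀ b ∈ s, a ⊓ b ≤ c) : ∃ d, (∀ b ∈ s, b ≤ d) ∧ c ≤ d ∧ a ⊓ d ≤ c := by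
  classical
  induction s using Finset.induction_on with
  | empty => exact ⟨c, by simp, le_rfl, inf_le_right⟩
  | insert b s hb ih =>
    obtain ⟨d, hsd, hcd, had⟩ := ih fun x hx => h x (Finset.mem_insert_of_mem hx)
    -- The new bound is the factor `d'` of `d` above `b`; as the other factor is above `a`, `a ⊓ d'
    -- = a ⊓ d`.
    obtain ⟨a', d', ha', hbd', rfl⟩ := hM a b d ((h b (Finset.mem_insert_self b s)).trans hcd)
    refine ⟨d', fun x hx => ?_, hcd.trans inf_le_right, ?_⟩
    · rcases Finset.mem_insert.1 hx with rfl | hx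
      exacts [hbd', (hsd x hx).trans inf_le_right]
    · exact (le_inf inf_le_left (inf_le_inf_right d' ha')).trans had

/-- `a` lies below all upper bounds of `s`. -/
def LeUpperBounds (a : M) (s : Finset M) : Prop := ∀ c, (∀ b ∈ s, b ≤ c) → a ≤ c

/-- Distributivity turns the formal inequality `a ≤ ⋁ s` into a join that exists in `M`, to which
maps preserving existing joins can be applied. -/
theorem isLUB_image_inf (hM : IsDistributiveMeetSemilattice M) [DecidableEq M] {a : M}
    {s : Finset M} (h : LeUpperBounds a s) :
    IsLUB ((s.image fun b => a ⊓ b : Finset M) : Set M) a := by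
  refine ⟨fun x hx => ?_, fun c hc => ?_⟩
  · obtain ⟨b, -, rfl⟩ := Finset.mem_image.1 hx
    exact inf_le_left
  · obtain ⟨d, hsd, -, had⟩ := exists_inf_le_of_forall_inf_le hM s
      fun b hb => hc (Finset.mem_image_of_mem (fun b => a ⊓ b) hb)
    exact (le_inf le_rfl (h d hsd)).trans had

variable [OrderTop M]

theorem PreservesExistingFiniteJoins.le_sup (hM : IsDistributiveMeetSemilattice M) {E : Type u}
    [DistribLattice E] [BoundedOrder E] {f : InfTopHom M E} (hf : PreservesExistingFiniteJoins f)
    {a : M} {s : Finset M} (h : LeUpperBounds a s) : f a ≤ s.sup f := by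
  classical
  refine (hf _ a (isLUB_image_inf hM h)).2 ?_
  rintro _ ⟨x, hx, rfl⟩
  obtain ⟨b, hb, rfl⟩ := Finset.mem_image.1 hx
  exact (OrderHomClass.mono f inf_le_right).trans (Finset.le_sup hb)

variable (M) in
/-- The map which sends `a` to the set of prime elements of the lattice of filters that contain
`a`. -/
def primeSet : InfTopHom M (Set {P : PFilter M // InfPrime P}) where
  toFun a := {P | a ∈ P.1}
  map_inf' a b := by
    ext P
    exact PFilter.inf_mem_iff
  map_top' := by
    ext P
    exact ⟨fun _ => trivial, fun _ => PFilter.top_mem⟩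

theorem mem_sup_primeSet {s : Finset M} {P : {P : PFilter M // InfPrime P}} :
    P ∈ s.sup (primeSet M) ↔ ∃ b ∈ s, b ∈ P.1 := by
  rw [Finset.sup_set_eq_biUnion]
  exact Set.mem_iUnion₂.trans ⟨fun ⟨b, hb, h⟩ => ⟨b, hb, h⟩, fun ⟨b, hb, h⟩ => ⟨b, hb, h⟩⟩

theorem le_finset_inf_principal_iff {s : Finset M} {c : M} :
    PFilter.principal c ≤ s.inf PFilter.principal ↔ ∀ b ∈ s, b ≤ c := by
  rw [Finset.le_inf_iff]
  exact forall₂_congr fun b _ => PFilter.principal_le_principal_iff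

/-- The intersection of the filters `↑b` is the set of common upper bounds of `s`. This is the
bridge between the envelope and the frame of filters. -/
theorem finset_inf_principal_le_iff {s : Finset M} {a : M} :
    s.inf PFilter.principal ≤ PFilter.principal a ↔ LeUpperBounds a s := by
  refine ⟨fun h c hc => ?_, fun h c hc => ?_⟩
  · exact PFilter.principal_le_principal_iff.1 ((le_finset_inf_principal_iff.2 hc).trans h)
  · exact h c (le_finset_inf_principal_iff.1 (PFilter.principal_le_iff.2 hc))

/-- A prime filter contains `⋂ ↑b` iff it contains some `b`, and prime filters separate the elements
of the frame of filters. -/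
theorem primeSet_le_sup_iff (hM : IsDistributiveMeetSemilattice M) {a : M} {s : Finset M} :
    primeSet M a ≤ s.sup (primeSet M) ↔ LeUpperBounds a s := by
  constructor
  · intro h
    rw [← finset_inf_principal_le_iff]
    by_contra hn
    have := isCompactlyGenerated_pfilter (M := M)
    obtain ⟨P, hP, haP, hsP⟩ := exists_prime_pp_of_not_le (isFrameLattice_pfilter hM) hn
    obtain ⟨b, hb, hbP⟩ := mem_sup_primeSet.1
      (@h ⟨P.1, hP⟩ (PFilter.principal_le_iff.1 haP))
    exact hsP ((Finset.inf_le hb).trans (PFilter.principal_le_iff.2 hbP))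
  · intro h P hP
    obtain ⟨b, hb, hbP⟩ := P.2.finset_inf_le.1
      ((finset_inf_principal_le_iff.2 h).trans (PFilter.principal_le_iff.2 hP))
    exact mem_sup_primeSet.2 ⟨b, hb, PFilter.principal_le_iff.1 hbP⟩

variable (M) in
/-- The sublattice generated by the image of `primeSet`. -/
def envelope : Sublattice (Set {P : PFilter M // InfPrime P}) where
  carrier := {V | ∃ s : Finset M, V = s.sup (primeSet M)}
  supClosed' := by
    classical
    rintro _ ⟨s, rfl⟩ _ ⟨t, rfl⟩
    exact ⟨s ∪ t, Finset.sup_union.symm⟩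
  infClosed' := by
    classical
    rintro _ ⟨s, rfl⟩ _ ⟨t, rfl⟩
    refine ⟨(s ×ˢ t).image fun i => i.1 ⊓ i.2, ?_⟩
    rw [Finset.sup_inf_sup, Finset.sup_image]
    exact Finset.sup_congr rfl fun i _ => (map_inf (primeSet M) i.1 i.2).symm

instance : BoundedOrder (envelope M) where
  top := ⟨⊤, {⊤}, by rw [Finset.sup_singleton, map_top]⟩
  le_top _ := Set.subset_univ _
  bot := ⟨⊥, ∅, Finset.sup_empty.symm⟩
  bot_le _ := Set.empty_subset _

variable (M) in
/-- The inclusion of a meet-semilattice into its envelope. -/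
def toEnvelope : InfTopHom M (envelope M) where
  toFun a := ⟨primeSet M a, {a}, Finset.sup_singleton.symm⟩
  map_inf' a b := Subtype.ext (map_inf (primeSet M) a b)
  map_top' := Subtype.ext (map_top (primeSet M))

theorem coe_sup_toEnvelope (s : Finset M) :
    ((s.sup (toEnvelope M) : envelope M) : Set _) = s.sup (primeSet M) := by
  classical
  induction s using Finset.induction_on with
  | empty => rfl
  | insert b s hb ih =>
    rw [Finset.sup_insert, Finset.sup_insert, ← ih]
    rfl

theorem toEnvelope_le_sup_iff (hM : IsDistributiveMeetSemilattice M) {a : M} {s : Finset M} :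
    toEnvelope M a ≤ s.sup (toEnvelope M) ↔ LeUpperBounds a s := by
  rw [← primeSet_le_sup_iff hM, ← coe_sup_toEnvelope]
  rfl

theorem exists_eq_sup_toEnvelope (V : envelope M) : ∃ s : Finset M, V = s.sup (toEnvelope M) := by
  obtain ⟨s, hs⟩ := V.2
  exact ⟨s, Subtype.ext (hs.trans (coe_sup_toEnvelope s).symm)⟩

theorem preserves_toEnvelope (hM : IsDistributiveMeetSemilattice M) :
    PreservesExistingFiniteJoins (toEnvelope M) := by
  intro s a ha
  refine ⟨?_, fun V hV => ?_⟩
  · rintro _ ⟨b, hb, rfl⟩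
    exact OrderHomClass.mono (toEnvelope M) (ha.1 hb)
  · exact ((toEnvelope_le_sup_iff hM).2 fun c hc => ha.2 hc).trans
      (Finset.sup_le fun b hb => hV ⟨b, hb, rfl⟩)

/-! ### The universal property of the envelope -/

section Lift

variable {E : Type u} [DistribLattice E] [BoundedOrder E] {f : InfTopHom M E}

theorem sup_le_sup_of_toEnvelope_le (hM : IsDistributiveMeetSemilattice M)
    (hf : PreservesExistingFiniteJoins f) {s t : Finset M}
    (h : s.sup (toEnvelope M) ≤ t.sup (toEnvelope M)) : s.sup f ≤ t.sup f :=
  Finset.sup_le fun _ ha =>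
    hf.le_sup hM ((toEnvelope_le_sup_iff hM).1 ((Finset.le_sup ha).trans h))

theorem exists_lift_apply (hM : IsDistributiveMeetSemilattice M)
    (hf : PreservesExistingFiniteJoins f) :
    ∃ g : envelope M → E, ∀ s : Finset M, g (s.sup (toEnvelope M)) = s.sup f := by
  -- The value at `V` uses a chosen representation of `V` as a join of generators; the preceding
  -- lemma makes it independent of the choice.
  choose r hr using exists_eq_sup_toEnvelope (M := M)
  exact ⟨fun V => (r V).sup f, fun s => le_antisymm
    (sup_le_sup_of_toEnvelope_le hM hf (hr _).ge) (sup_le_sup_of_toEnvelope_le hM hf (hr _).le)⟩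

theorem exists_lift (hM : IsDistributiveMeetSemilattice M)
    (hf : PreservesExistingFiniteJoins f) :
    ∃ g : BoundedLatticeHom (envelope M) E, ∀ a, g (toEnvelope M a) = f a := by
  classical
  obtain ⟨g, hg⟩ := exists_lift_apply hM hf
  have hga : ∀ a, g (toEnvelope M a) = f a := fun a => by
    have := hg {a}
    rwa [Finset.sup_singleton, Finset.sup_singleton] at this
  refine ⟨{ toFun := g, map_sup' := ?_, map_inf' := ?_, map_top' := ?_, map_bot' := hg ∅ }, hga⟩
  · intro V W
    obtain ⟨s, rfl⟩ := exists_eq_sup_toEnvelope V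
    obtain ⟨t, rfl⟩ := exists_eq_sup_toEnvelope W
    rw [← Finset.sup_union, hg, hg, hg, Finset.sup_union]
  · intro V W
    obtain ⟨s, rfl⟩ := exists_eq_sup_toEnvelope V
    obtain ⟨t, rfl⟩ := exists_eq_sup_toEnvelope W
    -- In every distributive lattice the meet of two finite joins is the same join of pairwise
    -- meets, already formed in `M`.
    have key : ∀ {D : Type u} [DistribLattice D] [BoundedOrder D] (h : InfTopHom M D),
        s.sup h ⊓ t.sup h = ((s ×ˢ t).image fun i => i.1 ⊓ i.2).sup h := fun h => by
      rw [Finset.sup_inf_sup, Finset.sup_image]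
      exact Finset.sup_congr rfl fun i _ => (map_inf h i.1 i.2).symm
    rw [key, hg, hg, hg, key]
  · have := hga ⊤
    rwa [map_top, map_top] at this

end Lift

theorem isDistributiveEnvelope_toEnvelope (hM : IsDistributiveMeetSemilattice M) :
    IsDistributiveEnvelope (toEnvelope M) where
  preserves := preserves_toEnvelope hM
  existsUnique E _ _ f hf := by
    obtain ⟨g, hg⟩ := exists_lift hM hf
    refine ⟨g, hg, fun g' hg' => ?_⟩
    apply BoundedLatticeHom.ext
    intro V
    obtain ⟨s, rfl⟩ := exists_eq_sup_toEnvelope V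
    rw [map_finset_sup, map_finset_sup]
    exact Finset.sup_congr rfl fun a _ => (hg' a).trans (hg a).symm

end Envelope

/-! ### Optimal filters -/

section OptimalFilters

variable {M : Type u} [SemilatticeInf M] [OrderTop M]

/-- A prime filter of any envelope meets every finite set whose join it contains. Conversely, the
condition says that the filter generated by `F` in the constructed envelope is disjoint from the
ideal generated by the images of the elements outside `F`; the prime ideal theorem separates the
two. -/
theorem isOptimal_iff (hM : IsDistributiveMeetSemilattice M) {F : PFilter M} :
    IsOptimal F ↔ ∀ (s : Finset M) (a : M), a ∈ F → LeUpperBounds a s → ∃ b ∈ s, b ∈ F := by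
  classical
  constructor
  · rintro ⟨D, _, _, e, he, P, hP, hPF⟩ s a ha hs
    by_contra! hn
    have hsup : s.sup e ∈ hP.compl_ideal.toIdeal :=
      (Ideal.finsetSup_mem_iff _).2 fun b hb hbP => hn b hb ((hPF b).2 hbP)
    exact hsup (PFilter.mem_of_le (he.preserves.le_sup hM hs) ((hPF a).1 ha))
  · intro h
    let I : Ideal (envelope M) :=
      { carrier := {V | ∃ s : Finset M, (∀ b ∈ s, b ∉ F) ∧ V ≤ s.sup (toEnvelope M)}
        lower' := fun V W hWV ⟨s, hs, hV⟩ => ⟨s, hs, hWV.trans hV⟩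
        nonempty' := ⟨⊥, ∅, by simp, bot_le⟩
        directed' := by
          rintro V ⟨s, hs, hV⟩ W ⟨t, ht, hW⟩
          refine ⟨V ⊔ W, ⟨s ∪ t, fun b hb => ?_, ?_⟩, le_sup_left, le_sup_right⟩
          · rcases Finset.mem_union.1 hb with hb | hb
            exacts [hs b hb, ht b hb]
          · rw [Finset.sup_union]
            exact sup_le_sup hV hW }
    have hdisj :
        Disjoint (filterMap (toEnvelope M) F : Set (envelope M)) (I : Set (envelope M)) := by
      rw [Set.disjoint_left]
      rintro V ⟨a, ha, haV⟩ ⟨s, hs, hVs⟩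
      obtain ⟨b, hb, hbF⟩ := h s a ha ((toEnvelope_le_sup_iff hM).1 (haV.trans hVs))
      exact hs b hb hbF
    obtain ⟨J, hJ, hIJ, hFJ⟩ := DistribLattice.prime_ideal_of_disjoint_filter_ideal hdisj
    refine ⟨_, _, _, toEnvelope M, isDistributiveEnvelope_toEnvelope hM, hJ.toPrimePair.F,
      hJ.toPrimePair.F_isPrime, fun a => ⟨fun ha => ?_, fun ha => ?_⟩⟩
    · exact Set.disjoint_left.1 hFJ ⟨a, ha, le_rfl⟩
    · by_contra hn
      exact ha (hIJ ⟨{a}, by simpa using hn, by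
        rw [Finset.sup_singleton]
        exact le_rfl⟩)

/-- Compact filters are principal, so the two conditions in terms of elements translate into each
other through `finset_inf_principal_le_iff`. -/
theorem isOptimal_iff_isPseudoprime (hM : IsDistributiveMeetSemilattice M)
    (hbot : ∃ b : M, ∀ a, b ≤ a) {F : PFilter M} : IsOptimal F ↔ IsPseudoprime F := by
  classical
  have := isCompactlyGenerated_pfilter (M := M)
  rw [isOptimal_iff hM, isPseudoprime_iff]
  constructor
  · intro h
    refine ⟨?_, fun s k hs hk hkF hsk => ?_⟩
    · rintro rfl
      obtain ⟨b, hb⟩ := hbot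
      -- The empty set expresses properness: the bottom lies below all elements, so it cannot belong
      -- to an optimal filter.
      obtain ⟨c, hc, -⟩ := h ∅ b
        ((le_top : PFilter.principal b ≤ ⊤) (PFilter.mem_principal.2 le_rfl)) fun c _ => hb c
      exact Finset.notMem_empty c hc
    · obtain ⟨a, rfl⟩ := isCompactElement_pfilter_iff.1 hk
      choose f hf using fun G : s => isCompactElement_pfilter_iff.1 (hs G.1 G.2)
      obtain ⟨b, hb, hbF⟩ := h (s.attach.image f) a (PFilter.principal_le_iff.1 hkF) (by
        rw [← finset_inf_principal_le_iff, Finset.inf_image]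
        refine le_trans (Finset.le_inf fun G hG => ?_) hsk
        exact (Finset.inf_le (Finset.mem_attach s ⟨G, hG⟩)).trans (hf ⟨G, hG⟩).le)
      obtain ⟨G, -, rfl⟩ := Finset.mem_image.1 hb
      exact ⟨G.1, G.2, hf G ▸ PFilter.principal_le_iff.2 hbF⟩
  · rintro ⟨-, h⟩ s a ha hs
    obtain ⟨G, hG, hGF⟩ := h (s.image PFilter.principal) (PFilter.principal a) (fun G hG => by
      obtain ⟨b, -, rfl⟩ := Finset.mem_image.1 hG
      exact isCompactElement_principal b) (isCompactElement_principal a)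
      (PFilter.principal_le_iff.2 ha) (by
        rw [Finset.inf_image]
        exact finset_inf_principal_le_iff.2 hs)
    obtain ⟨b, hb, rfl⟩ := Finset.mem_image.1 hG
    exact ⟨b, hb, PFilter.principal_le_iff.1 hGF⟩

theorem isPrimeFilter_iff_infPrime {P : PFilter M} : IsPrimeFilter P ↔ InfPrime P := by
  refine and_congr (not_iff_not.1 ?_) (forall₂_congr fun F G => imp_congr_left ?_)
  · rw [not_not, isMax_iff_eq_top, not_exists_not]
    refine ⟨fun h => top_le_iff.1 fun a _ => h a, ?_⟩
    rintro rfl a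
    exact (le_top : PFilter.principal a ≤ ⊤) (PFilter.mem_principal.2 le_rfl)
  · exact ⟨fun h a ha => h (mem_pfilter_inf.1 ha), fun h a ha => h (mem_pfilter_inf.2 ha)⟩

theorem instTopologicalSpaceOpt_eq_induced :
    (inferInstance : TopologicalSpace (Opt M)) =
      TopologicalSpace.induced Subtype.val (compactTopology (PFilter M)) := by
  rw [induced_generateFrom_eq]
  refine congrArg TopologicalSpace.generateFrom ?_
  have key : ∀ a : M, {x : Opt M | a ∈ x.1} = Subtype.val ⁻¹' Set.Ici (PFilter.principal a) :=
    fun a => Set.ext fun x => PFilter.principal_le_iff.symm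
  rw [Set.image_union]
  congr 1
  · ext U
    constructor
    · rintro ⟨a, rfl⟩
      exact ⟨_, ⟨_, isCompactElement_principal a, rfl⟩, (key a).symm⟩
    · rintro ⟨_, ⟨k, hk, rfl⟩, rfl⟩
      obtain ⟨a, rfl⟩ := isCompactElement_pfilter_iff.1 hk
      exact ⟨a, (key a).symm⟩
  · ext U
    constructor
    · rintro ⟨a, rfl⟩
      exact ⟨_, ⟨_, isCompactElement_principal a, rfl⟩, congrArg compl (key a).symm⟩
    · rintro ⟨_, ⟨k, hk, rfl⟩, rfl⟩
      obtain ⟨a, rfl⟩ := isCompactElement_pfilter_iff.1 hk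
      exact ⟨a, congrArg compl (key a).symm⟩

/-- A property of subspaces with a distinguished subset depends only on the underlying sets. -/
theorem subtype_transport {T : Type u} (τ : TopologicalSpace T)
    (Q : ∀ (p : T → Prop) (_ : TopologicalSpace {x // p x}) (_ : Set {x // p x}), Prop)
    {p q r r' : T → Prop} (hpq : ∀ x, p x ↔ q x) (hr : ∀ x, r x ↔ r' x)
    (h : Q p (TopologicalSpace.induced Subtype.val τ) {x | r x.1}) :
    Q q (TopologicalSpace.induced Subtype.val τ) {x | r' x.1} := by
  obtain rfl : p = q := funext fun x => propext (hpq x)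
  obtain rfl : r = r' := funext fun x => propext (hr x)
  exact h

/-- `Opt M` and `PP (PFilter M)` are subtypes for equivalent predicates, with matching topologies
and primes, so a property formulated for arbitrary predicates transfers. -/
theorem opt_of_pp (hM : IsDistributiveMeetSemilattice M) (hbot : ∃ b : M, ∀ a, b ≤ a)
    (Q : ∀ (p : PFilter M → Prop) (_ : TopologicalSpace {x // p x}) (_ : Set {x // p x}), Prop)
    (h : Q IsPseudoprime inferInstance (PP.primes (PFilter M))) :
    Q IsOptimal inferInstance (Opt.primes M) := by
  rw [instTopologicalSpaceOpt_eq_induced]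
  exact subtype_transport (compactTopology (PFilter M)) Q
    (fun F => (isOptimal_iff_isPseudoprime hM hbot).symm)
    (fun P => isPrimeFilter_iff_infPrime.symm) h

end OptimalFilters

/-! ### The space of optimal filters -/

section OptimalSpace

variable {M N : BDMS.{u}}

theorem isGPS_opt (M : BDMS.{u}) : IsGPS (Opt M.obj) (Opt.primes M.obj) := by
  have := isCompactlyGenerated_pfilter (M := M.obj)
  exact opt_of_pp M.2.1 M.2.2 (fun p _ X₀ => IsGPS {x // p x} X₀)
    (isGPS_pp (isFrameLattice_pfilter M.2.1)
      (M.2.2.elim fun _ hb => isCompactElement_top_pfilter hb))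

theorem isAdmissible_opt_iff {U : Set (Opt M.obj)} :
    IsAdmissible (Opt.primes M.obj) U ↔ ∃ a : M.obj, U = {x | a ∈ x.1} := by
  have := isCompactlyGenerated_pfilter (M := M.obj)
  refine opt_of_pp M.2.1 M.2.2 (fun p _ X₀ => ∀ U : Set {x // p x},
    IsAdmissible X₀ U ↔ ∃ a : M.obj, U = {x | a ∈ x.1}) (fun U => ?_) U
  rw [isAdmissible_pp_iff (isFrameLattice_pfilter M.2.1)
    (M.2.2.elim fun _ hb => isCompactElement_top_pfilter hb)]
  simp only [isCompactElement_pfilter_iff, exists_exists_eq_and, PFilter.principal_le_iff]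

theorem exists_opt_of_notMem {F : PFilter M.obj} {a : M.obj} (ha : a ∉ F) :
    ∃ x : Opt M.obj, F ≤ x.1 ∧ a ∉ x.1 := by
  have := isCompactlyGenerated_pfilter (M := M.obj)
  obtain ⟨p, -, hFp, hap⟩ := exists_prime_pp_of_not_le (isFrameLattice_pfilter M.2.1)
    (fun h => ha (PFilter.principal_le_iff.1 h) : ¬ PFilter.principal a ≤ F)
  exact ⟨⟨p.1, (isOptimal_iff_isPseudoprime M.2.1 M.2.2).2 p.2⟩, hFp,
    fun h => hap (PFilter.principal_le_iff.2 h)⟩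

/-- If `α a ∉ x`, the filter `α⁻¹(x)` misses `a` and extends to an optimal filter that still misses
`a`. -/
theorem box_optRel (α : InfTopHom M.obj N.obj) (a : M.obj) :
    box (optRel α) {y | a ∈ y.1} = {x | α a ∈ x.1} := by
  ext x
  refine ⟨fun h => ?_, fun h y hy => hy a h⟩
  by_contra hn
  obtain ⟨y, hxy, hay⟩ := exists_opt_of_notMem (F := filterComap α x.1) (a := a) hn
  exact hay (h y fun b hb => hxy hb)

theorem isGPMorphism_optRel (α : InfTopHom M.obj N.obj) :
    IsGPMorphism (Opt.primes N.obj) (Opt.primes M.obj) (optRel α) where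
  exists_of_not_rel x y h := by
    unfold optRel at h
    push Not at h
    obtain ⟨a, hax, hay⟩ := h
    exact ⟨_, isAdmissible_opt_iff.2 ⟨a, rfl⟩, fun z hz => hz a hax, hay⟩
  box_admissible U hU := by
    obtain ⟨a, rfl⟩ := isAdmissible_opt_iff.1 hU
    rw [box_optRel]
    exact isAdmissible_opt_iff.2 ⟨α a, rfl⟩

end OptimalSpace

theorem optWellDefined : OptWellDefined.{u} where
  isGPS := isGPS_opt
  isGPMorphism α := isGPMorphism_optRel (BDMS.toHom α)
  map_comp {M N K} α β := by
    funext x y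
    refine propext ((isGPMorphism_optRel (BDMS.toHom (α ≫ β))).rel_iff.trans ?_)
    refine forall₂_congr fun U hU => ?_
    obtain ⟨a, rfl⟩ := isAdmissible_opt_iff.1 hU
    rw [box_optRel, box_optRel, box_optRel]
    rfl

/-! ### The comparison of the dualities -/

section Comparison

variable (hF : FilterWellDefined.{u}) (hX : OptWellDefined.{u}) (hY : PPWellDefined.{u})

/-- The space of optimal filters of `M`. -/
abbrev optSpace (M : BDMS.{u}) : GPS.{u} := ((optFunctor hX).obj M).unop

/-- The space of pseudoprime filters of `M`. -/
abbrev ppSpace (M : BDMS.{u}) : GPS.{u} := ((filterFunctor hF ⋙ ppFunctor hY).obj M).unop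

theorem isAdmissible_ppSpace_iff {M : BDMS.{u}} {U : Set (PP (PFilter M.obj))} :
    IsAdmissible (PP.primes (PFilter M.obj)) U ↔
      ∃ a : M.obj, U = {P | PFilter.principal a ≤ P.1} := by
  have := isCompactlyGenerated_pfilter (M := M.obj)
  rw [isAdmissible_pp_iff (isFrameLattice_pfilter M.2.1)
    (M.2.2.elim fun _ hb => isCompactElement_top_pfilter hb)]
  constructor
  · rintro ⟨k, hk, rfl⟩
    obtain ⟨a, rfl⟩ := isCompactElement_pfilter_iff.1 hk
    exact ⟨a, rfl⟩
  · rintro ⟨a, rfl⟩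
    exact ⟨_, isCompactElement_principal a, rfl⟩

theorem box_pp_le_opt {M : BDMS.{u}} (a : M.obj) :
    box (fun (P : PP (PFilter M.obj)) (F : Opt M.obj) => P.1 ≤ F.1) {F | a ∈ F.1} =
      {P | PFilter.principal a ≤ P.1} := by
  ext P
  exact ⟨fun h => PFilter.principal_le_iff.2
    (h ⟨P.1, (isOptimal_iff_isPseudoprime M.2.1 M.2.2).2 P.2⟩ le_rfl),
    fun h F hF => hF (PFilter.principal_le_iff.1 h)⟩

theorem box_opt_le_pp {M : BDMS.{u}} (a : M.obj) :
    box (fun (F : Opt M.obj) (P : PP (PFilter M.obj)) => F.1 ≤ P.1)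
      {P | PFilter.principal a ≤ P.1} = {F | a ∈ F.1} := by
  ext F
  exact ⟨fun h => PFilter.principal_le_iff.1
    (h ⟨F.1, (isOptimal_iff_isPseudoprime M.2.1 M.2.2).1 F.2⟩ le_rfl),
    fun h P hP => PFilter.principal_le_iff.2 (hP h)⟩

theorem isGPMorphism_pp_le_opt (M : BDMS.{u}) :
    IsGPMorphism (PP.primes (PFilter M.obj)) (Opt.primes M.obj) fun P F => P.1 ≤ F.1 where
  exists_of_not_rel P F h := by
    obtain ⟨a, haP, haF⟩ := Set.not_subset.1 h
    exact ⟨_, isAdmissible_opt_iff.2 ⟨a, rfl⟩, fun G hG => hG haP, haF⟩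
  box_admissible U hU := by
    obtain ⟨a, rfl⟩ := isAdmissible_opt_iff.1 hU
    rw [box_pp_le_opt]
    exact isAdmissible_ppSpace_iff.2 ⟨a, rfl⟩

theorem isGPMorphism_opt_le_pp (M : BDMS.{u}) :
    IsGPMorphism (Opt.primes M.obj) (PP.primes (PFilter M.obj)) fun F P => F.1 ≤ P.1 where
  exists_of_not_rel F P h := by
    obtain ⟨a, haF, haP⟩ := Set.not_subset.1 h
    exact ⟨_, isAdmissible_ppSpace_iff.2 ⟨a, rfl⟩, fun G hG => PFilter.principal_le_iff.2 (hG haF),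
      fun h => haP (PFilter.principal_le_iff.1 h)⟩
  box_admissible U hU := by
    obtain ⟨a, rfl⟩ := isAdmissible_ppSpace_iff.1 hU
    rw [box_opt_le_pp]
    exact isAdmissible_opt_iff.2 ⟨a, rfl⟩

/-- The spaces of pseudoprime and optimal filters are isomorphic. -/
def ppSpaceIso (M : BDMS.{u}) : ppSpace hF hY M ≅ optSpace hX M where
  hom := ⟨fun P F => P.1 ≤ F.1, isGPMorphism_pp_le_opt M⟩
  inv := ⟨fun F P => F.1 ≤ P.1, isGPMorphism_opt_le_pp M⟩
  hom_inv_id := by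
    refine GPSHom.ext_box fun U hU => (box_relComp _ _ _ hU).trans ?_
    refine Eq.trans ?_ (box_le hU.2.1).symm
    obtain ⟨a, rfl⟩ := isAdmissible_ppSpace_iff.1 hU
    exact (congrArg (box _) (box_opt_le_pp a)).trans (box_pp_le_opt a)
  inv_hom_id := by
    refine GPSHom.ext_box fun U hU => (box_relComp _ _ _ hU).trans ?_
    refine Eq.trans ?_ (box_le hU.2.1).symm
    obtain ⟨a, rfl⟩ := isAdmissible_opt_iff.1 hU
    exact (congrArg (box _) (box_pp_le_opt a)).trans (box_opt_le_pp a)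

/-- `𝒳 ≅ 𝒴 ∘ ℱ`. -/
def optPPIso : optFunctor hX ≅ filterFunctor hF ⋙ ppFunctor hY :=
  NatIso.ofComponents (fun M => (ppSpaceIso hF hX hY M).op) fun {M N} α => by
    apply Quiver.Hom.unop_inj
    refine GPSHom.ext_box fun U hU => (box_relComp _ _ _ hU).trans
      (Eq.trans ?_ (box_relComp _ _ _ hU).symm)
    obtain ⟨a, rfl⟩ := isAdmissible_opt_iff.1 hU
    have := isCompactlyGenerated_pfilter (M := M.obj)
    -- Both composites send the set of filters containing `a` to the set of those containing `α a`.
    have h₁ := (congrArg (box fun (P : PP (PFilter N.obj)) (F : Opt N.obj) => P.1 ≤ F.1)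
      (box_optRel (BDMS.toHom α) a)).trans (box_pp_le_opt (BDMS.toHom α a))
    have h₂ := (congrArg (box (ppRel (KAlgFrmJ.toHom ((filterFunctor hF).map α))))
      (box_pp_le_opt a)).trans (box_ppRel (isFrameLattice_pfilter M.2.1)
        (KAlgFrmJ.toHom ((filterFunctor hF).map α)) (PFilter.principal a))
    refine h₁.trans (Eq.trans ?_ h₂.symm)
    exact congrArg (fun F => {P : PP (PFilter N.obj) | F ≤ P.1})
      (filterMap_principal (BDMS.toHom α) a).symm

/-- Generalized Priestley duality. -/
noncomputable def optEquivalence (hK : CompactWellDefined.{u}) (hA : AdmWellDefined.{u}) :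
    BDMS.{u} ≌ GPS.{u}ᵒᵖ :=
  -- Only the functor is replaced, along `𝒜⁻¹ ≅ 𝒜⁻¹ ∘ 𝒦 ∘ ℱ ≅ 𝒴 ∘ ℱ ≅ 𝒳`; the inverse remains `𝒜`.
  (admEquivalence hA).changeFunctor
    ((Functor.leftUnitor _).symm ≪≫
      Functor.isoWhiskerRight (filterUnitIso hF hK) (admEquivalence hA).functor ≪≫
      Functor.associator _ _ _ ≪≫
      Functor.isoWhiskerLeft (filterFunctor hF) (compactAdmInverseIso hK hA hY) ≪≫
      (optPPIso hF hX hY).symm)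

end Comparison

end GenPriestley

theorem mainTheorem3 :
    -- all six prescriptions define functors
    ∃ (hF : FilterWellDefined.{u}) (hK : CompactWellDefined.{u}) (hA : AdmWellDefined.{u})
      (hX : OptWellDefined.{u}) (hV : VietorisWellDefined.{u}) (hY : PPWellDefined.{u}),
      -- the equivalence of bounded distributive meet-semilattices and compact algebraic frames
      (∃ e : BDMS.{u} ≌ KAlgFrmJ.{u},
        e.functor = filterFunctor hF ∧ e.inverse = compactFunctor hK) ∧
      -- the dual equivalence of compact algebraic frames and generalized Priestley spaces
      (∃ e : KAlgFrmJ.{u} ≌ GPS.{u}ᵒᵖ,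
        e.functor = ppFunctor hY ∧ e.inverse = vietorisFunctor hV) ∧
      -- generalized Priestley duality
      (∃ e : BDMS.{u} ≌ GPS.{u}ᵒᵖ,
        e.functor = optFunctor hX ∧ e.inverse = admFunctor hA) ∧
      -- the functors of the last duality are the compositions of the others
      (∀ (M : BDMS.{u}) (F : PFilter M.obj), IsOptimal F ↔ IsPseudoprime F) ∧
      (∃ e : optFunctor hX ≅ filterFunctor hF ⋙ ppFunctor hY,
        ∀ (M : BDMS.{u}) (P : PP (PFilter M.obj)) (F : Opt M.obj),
          (GPS.toHom (e.hom.app M).unop).rel P F ↔ P.1 ≤ F.1) ∧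
      (∃ e : admFunctor hA ≅ vietorisFunctor hV ⋙ compactFunctor hK,
        ∀ (X : GPS.{u}) (U : Adm X),
          (OrderDual.ofDual (BDMS.toHom (e.hom.app (op X)) U : CompactsDual (ClosedAdm X))).1.1
            = U.1) := by
  refine ⟨filterWellDefined, compactWellDefined, admWellDefined, optWellDefined,
    vietorisWellDefined, ppWellDefined,
    ⟨filterEquivalence filterWellDefined compactWellDefined, rfl, rfl⟩,
    ⟨ppEquivalence filterWellDefined compactWellDefined admWellDefined vietorisWellDefined
      ppWellDefined, rfl, rfl⟩,
    ⟨optEquivalence filterWellDefined optWellDefined ppWellDefined compactWellDefined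
      admWellDefined, rfl, rfl⟩,
    fun M F => isOptimal_iff_isPseudoprime M.2.1 M.2.2,
    ⟨optPPIso filterWellDefined optWellDefined ppWellDefined, fun M P F => Iff.rfl⟩,
    ⟨admVietorisIso admWellDefined vietorisWellDefined compactWellDefined, fun X U => rfl⟩⟩
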